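/- Let $d\ge 1$ and $\gamma>0$, and write $\mathbb{T}^d=(\mathbb{R}/\mathbb{Z})^d$. For $f\in L_2(\mathbb{T}^d)$ with Fourier coefficients $\widehat f(\boldsymbol h)=\int_{\mathbb{T}^d} f(\boldsymbol x)e^{-2\pi i\,\boldsymbol h\cdot\boldsymbol x}\,d\boldsymbol x$, say that $f\in E_\alpha(\mathbb{T}^d)$ if $\sum_{\boldsymbol h\in\mathbb{Z}^d}|\widehat f(\boldsymbol h)|^2\prod_{j=1}^d\max(|h_j|^{2\alpha},1)<\infty$; functions in $E_\alpha(\mathbb{T}^d)$ with $\alpha>1/2$ are identified with their continuous representatives. Let $1\le r\le d$, let $Z=(\boldsymbol z_1,\dots,\boldsymbol z_r)\in\mathbb{Z}^{d\times r}$ and $\boldsymbol n=(n_1,\dots,n_r)\in\mathbb{N}^r$ ($n_j\ge1$) define a rank-$r$ lattice in canonical form: $n_{j+1}\mid n_j$ for $1\le j<r$, the vectors $\boldsymbol z_1,\dots,\boldsymbol z_r$ are linearly independent over $\mathbb{Q}$, and for each $j$ the components of $\boldsymbol z_j$ together with $n_j$ have greatest common divisor $1$. Put $n=\prod_j n_j$,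 $\mathbb{Z}_m=\{0,\dots,m-1\}$, $\mathcal I=\mathbb{Z}_{n_1}\times\cdots\times\mathbb{Z}_{n_r}$, and $\boldsymbol p_{\boldsymbol k}=\bigl(\sum_j \boldsymbol z_jk_j/n_j\bigr)\bmod 1$ for $\boldsymbol k\in\mathcal I$. Let $\mathcal A\subset\mathbb{Z}^d$ be an anti-aliasing set (for distinct $\boldsymbol h,\boldsymbol h'\in\mathcal A$ never $Z^\top\boldsymbol h\equiv Z^\top\boldsymbol h'\pmod{\boldsymbol n}$, componentwise) with $|\mathcal A|=n$, enumerated as $\mathcal A=\{\boldsymbol h_{\boldsymbol\xi}:\boldsymbol\xi\in\mathcal I\}$ with $Z^\top\boldsymbol h_{\boldsymbol\xi}\equiv\boldsymbol\xi\pmod{\boldsymbol n}$, and suppose that every $\boldsymbol h_{\boldsymbol\xi}$ has minimal $\ell_2$ norm among all $\boldsymbol h'\in\mathbb{Z}^d$ with $Z^\top\boldsymbol h'\equiv\boldsymbol\xi\pmod{\boldsymbol n}$. Let $v\in E_\alpha(\mathbb{T}^d)$ with $\alpha\ge2$ be a real-valued potential and $g\in E_\beta(\mathbb{T}^d)$ with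 $\beta\ge2$ a complex-valued initial condition for the time-dependent Schrödinger equation $i\gamma\,\partial_tu=-\tfrac{\gamma^2}{2}\nabla^2u+vu$ on $\mathbb{T}^d$. Let $F_{\boldsymbol n}=\bigl(\prod_j n_j^{-1/2}e^{-2\pi i\,k_j\xi_j/n_j}\bigr)_{\boldsymbol\xi,\boldsymbol k\in\mathcal I}$ be the unitary $r$-dimensional discrete Fourier matrix, $V_{\boldsymbol n}=\mathrm{diag}(v(\boldsymbol p_{\boldsymbol k}))_{\boldsymbol k\in\mathcal I}$, $W_{\boldsymbol n}=F_{\boldsymbol n}V_{\boldsymbol n}F_{\boldsymbol n}^{-1}$, $D_{\boldsymbol n}=\mathrm{diag}(4\pi^2\|\boldsymbol h_{\boldsymbol\xi}\|_2^2)_{\boldsymbol\xi\in\mathcal I}$ and $D=\tfrac{\gamma}{2}D_{\boldsymbol n}$. Let $\widehat{\boldsymbol g}_a=\bigl(\tfrac1n\sum_{\boldsymbol k\in\mathcal I}g(\boldsymbol p_{\boldsymbol k})e^{-2\pi i\,\boldsymbol h_{\boldsymbol\xi}\cdot\boldsymbol p_{\boldsymbol k}}\bigr)_{\boldsymbol\xi\in\mathcal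 I}$ and let $\widehat{\boldsymbol u}_t\in\mathbb{C}^{\mathcal I}$, $t\in[0,T]$, solve the lattice-collocated Fourier ODE $$ i\gamma\,\widehat{\boldsymbol u}_t'=\tfrac12\gamma^2D_{\boldsymbol n}\widehat{\boldsymbol u}_t+W_{\boldsymbol n}\widehat{\boldsymbol u}_t,\qquad \widehat{\boldsymbol u}_0=\widehat{\boldsymbol g}_a .$$ For $\Delta t>0$ let $\widehat{\boldsymbol u}_a^0=\widehat{\boldsymbol g}_a$ and let the Strang splitting iterates be $$\widehat{\boldsymbol u}_a^{k+1}=e^{-\frac{i}{2\gamma}W_{\boldsymbol n}\Delta t}\,e^{-\frac{i\gamma}{2}D_{\boldsymbol n}\Delta t}\,e^{-\frac{i}{2\gamma}W_{\boldsymbol n}\Delta t}\,\widehat{\boldsymbol u}_a^k .$$ Let $u_a(\boldsymbol x,t)=\sum_{\boldsymbol\xi}(\widehat{\boldsymbol u}_t)_{\boldsymbol\xi}e^{2\pi i\,\boldsymbol h_{\boldsymbol\xi}\cdot\boldsymbol x}$ and $u_a^k(\boldsymbol x)=\sum_{\boldsymbol\xi}(\widehat{\boldsymbol u}_a^k)_{\boldsymbol\xi}e^{2\pi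 i\,\boldsymbol h_{\boldsymbol\xi}\cdot\boldsymbol x}$. Then there are constants $C_1,C_2>0$, depending only on $d,\gamma,\alpha,v$ (so independent of the lattice and its size $n$, of $\mathcal A$, $g$, $T$, $k$ and $\Delta t$), such that for all $k\ge0$ and $\Delta t>0$ with $t=k\Delta t\le T$: (i) if $\alpha>5/2$, then $\displaystyle \|u_a^k-u_a(\cdot,t)\|_{L_2(\mathbb{T}^d)}\le \Delta t\;C_1\,t\max_{0\le t'\le t}\|(D+I)\,\widehat{\boldsymbol u}_{t'}\|_2$; (ii) if $\alpha>9/2$, then $\displaystyle \|u_a^k-u_a(\cdot,t)\|_{L_2(\mathbb{T}^d)}\le (\Delta t)^2\,C_2\,t\max_{0\le t'\le t}\|(D+I)^2\,\widehat{\boldsymbol u}_{t'}\|_2$. In particular the smoothness thresholds $5/2$ and $9/2$ do not depend on $d$. -/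

import Mathlib

open MeasureTheory Matrix

noncomputable section

namespace LatticeTDSE

/-! Functions on the torus `𝕋ᵈ = (ℝ/ℤ)ᵈ` are functions on `UnitAddTorus (Fin d)`;
`UnitAddTorus.mFourier h` is the character `x ↦ exp(2πi h·x)` and `UnitAddTorus.mFourierCoeff f h`
is the Fourier coefficient `∫ f(x) exp(-2πi h·x) dx`. -/

/-- The Lebesgue (Haar probability) measure on the `d`-dimensional torus. -/
def torusMeasure (d : ℕ) : Measure (UnitAddTorus (Fin d)) :=
  Measure.pi fun _ => AddCircle.haarAddCircle

/-- The squared Korobov weight `r_α²(h) = ∏ⱼ max(|hⱼ|^{2α}, 1)`. -/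
def korobovWeightSq {d : ℕ} (α : ℝ) (h : Fin d → ℤ) : ℝ :=
  ∏ j, max (|(h j : ℝ)| ^ (2 * α)) 1

/-- Membership of `f` in the Korobov space `E_α(𝕋ᵈ)`: `f ∈ L₂` and
`∑ₕ |f̂(h)|² r_α²(h) < ∞`. -/
def MemKorobov {d : ℕ} (α : ℝ) (f : UnitAddTorus (Fin d) → ℂ) : Prop :=
  MemLp f 2 (torusMeasure d) ∧
    Summable fun h : Fin d → ℤ =>
      ‖UnitAddTorus.mFourierCoeff f h‖ ^ 2 * korobovWeightSq α h

/-- The Euclidean norm of a complex vector. -/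
def l2norm {ι : Type*} [Fintype ι] (y : ι → ℂ) : ℝ :=
  ‖(WithLp.toLp 2 y : EuclideanSpace ℂ ι)‖

/-- The Euclidean norm `‖h‖₂` of an integer frequency vector. -/
def freqNorm {d : ℕ} (h : Fin d → ℤ) : ℝ :=
  ‖(WithLp.toLp 2 fun i => (h i : ℝ) : EuclideanSpace ℝ (Fin d))‖

/-- A rank-`r` lattice in canonical form: the columns `z₁, …, z_r` of `Z` are the generating
vectors and `n₁, …, n_r` the moduli. -/
structure IsCanonical {d r : ℕ} (Z : Matrix (Fin d) (Fin r) ℤ) (n : Fin r → ℕ) : Prop where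
  one_le_rank : 1 ≤ r
  modulus_pos : ∀ j, 0 < n j
  /-- `n_{j+1}` divides `n_j`. -/
  dvd : ∀ i j : Fin r, (j : ℕ) = i + 1 → n j ∣ n i
  /-- The generating vectors are linearly independent over the rationals. -/
  linInd : LinearIndependent ℚ fun (j : Fin r) (i : Fin d) => (Z i j : ℚ)
  /-- The components of `z_j` are, jointly, relatively prime to `n_j`. -/
  coprime : ∀ (j : Fin r) (q : ℕ), q ∣ n j → (∀ i, (q : ℤ) ∣ Z i j) → q = 1

/-- Multi-indices `ℤ_{n₁} ⊕ ⋯ ⊕ ℤ_{n_r}`, with `ℤ_m = {0, …, m - 1}`. -/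
abbrev MultiIndex {r : ℕ} (n : Fin r → ℕ) : Type := ∀ j : Fin r, Fin (n j)

/-- The lattice point `p_k = (z₁ k₁ / n₁ + ⋯ + z_r k_r / n_r) mod 1`. -/
def latticePoint {d r : ℕ} (Z : Matrix (Fin d) (Fin r) ℤ) (n : Fin r → ℕ) (k : MultiIndex n) :
    UnitAddTorus (Fin d) :=
  fun i => ((∑ j, (Z i j : ℝ) * ((k j : ℕ) : ℝ) / (n j : ℝ) : ℝ) : UnitAddCircle)

/-- `Zᵀ h ≡ Zᵀ h' (mod n)`, componentwise. -/
def SameClass {d r : ℕ} (Z : Matrix (Fin d) (Fin r) ℤ) (n : Fin r → ℕ) (h h' : Fin d → ℤ) : Prop :=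
  ∀ j, (Zᵀ *ᵥ h) j ≡ (Zᵀ *ᵥ h') j [ZMOD (n j : ℤ)]

/-- `Zᵀ h ≡ ξ (mod n)`, componentwise, for a multi-index `ξ`; that is, `h ∈ A(Z, n, ξ)`. -/
def HasIndex {d r : ℕ} (Z : Matrix (Fin d) (Fin r) ℤ) (n : Fin r → ℕ) (h : Fin d → ℤ)
    (ξ : MultiIndex n) : Prop :=
  ∀ j, (Zᵀ *ᵥ h) j ≡ ((ξ j : ℕ) : ℤ) [ZMOD (n j : ℤ)]

/-- An anti-aliasing set: no two distinct elements are in the same class. -/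
def IsAntiAliasing {d r : ℕ} (Z : Matrix (Fin d) (Fin r) ℤ) (n : Fin r → ℕ)
    (A : Finset (Fin d → ℤ)) : Prop :=
  ∀ h ∈ A, ∀ h' ∈ A, h ≠ h' → ¬ SameClass Z n h h'

/-- An anti-aliasing set `A` of full cardinality `∏ n_j`, with its enumeration
`A = {h_ξ : ξ ∈ ℤ_{n₁} ⊕ ⋯ ⊕ ℤ_{n_r}}`, `Zᵀ h_ξ ≡ ξ (mod n)`, in which every `h_ξ` has minimal
Euclidean norm in its class. -/
structure IsMinimalAntiAliasing {d r : ℕ} (Z : Matrix (Fin d) (Fin r) ℤ) (n : Fin r → ℕ)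
    (A : Finset (Fin d → ℤ)) (h : MultiIndex n → (Fin d → ℤ)) : Prop where
  antiAliasing : IsAntiAliasing Z n A
  full : A.card = ∏ j, n j
  mem : ∀ ξ, h ξ ∈ A
  index : ∀ ξ, HasIndex Z n (h ξ) ξ
  minimal : ∀ ξ (h' : Fin d → ℤ), HasIndex Z n h' ξ → freqNorm (h ξ) ≤ freqNorm h'

/-- The approximate Fourier coefficient `f̂_a(h) = (1/n) ∑_p f(p) exp(-2πi h·p)`, calculated by the
lattice rule. -/
def latticeCoeff {d r : ℕ} (Z : Matrix (Fin d) (Fin r) ℤ) (n : Fin r → ℕ)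
    (f : UnitAddTorus (Fin d) → ℂ) (h : Fin d → ℤ) : ℂ :=
  ((∏ j, n j : ℕ) : ℂ)⁻¹ *
    ∑ k : MultiIndex n, f (latticePoint Z n k) * UnitAddTorus.mFourier (-h) (latticePoint Z n k)

/-- The trigonometric polynomial `x ↦ ∑_ξ c_ξ exp(2πi h_ξ·x)`. -/
def trigPoly {d : ℕ} {ι : Type*} [Fintype ι] (h : ι → (Fin d → ℤ)) (c : ι → ℂ)
    (x : UnitAddTorus (Fin d)) : ℂ :=
  ∑ ξ, c ξ * UnitAddTorus.mFourier (h ξ) x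

/-- The unitary `r`-dimensional discrete Fourier matrix `F_n = F_{n₁} ⊗ ⋯ ⊗ F_{n_r}`. -/
def dftMatrix {r : ℕ} (n : Fin r → ℕ) : Matrix (MultiIndex n) (MultiIndex n) ℂ :=
  Matrix.of fun ξ k => ∏ j, ((Real.sqrt (n j) : ℝ) : ℂ)⁻¹ *
    Complex.exp (-2 * Real.pi * Complex.I * ((k j : ℕ) : ℂ) * ((ξ j : ℕ) : ℂ) / (n j : ℂ))

/-- `V_n`, the diagonal matrix of the values of the potential at the lattice points. -/
def potentialMatrix {d r : ℕ} (Z : Matrix (Fin d) (Fin r) ℤ) (n : Fin r → ℕ)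
    (v : UnitAddTorus (Fin d) → ℝ) : Matrix (MultiIndex n) (MultiIndex n) ℂ :=
  Matrix.diagonal fun k => ((v (latticePoint Z n k) : ℝ) : ℂ)

/-- `W_n = F_n V_n F_n⁻¹`. -/
def Wmat {d r : ℕ} (Z : Matrix (Fin d) (Fin r) ℤ) (n : Fin r → ℕ)
    (v : UnitAddTorus (Fin d) → ℝ) : Matrix (MultiIndex n) (MultiIndex n) ℂ :=
  dftMatrix n * potentialMatrix Z n v * (dftMatrix n)⁻¹

/-- `D_n = diag(4π² ‖h_ξ‖₂²)`. -/
def Dmat {d : ℕ} {ι : Type*} [DecidableEq ι] (h : ι → (Fin d → ℤ)) : Matrix ι ι ℂ :=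
  Matrix.diagonal fun ξ => ((4 * Real.pi ^ 2 * freqNorm (h ξ) ^ 2 : ℝ) : ℂ)

/-- `û : [0, T] → ℂ^ι` solves `i γ û' = (γ²/2) D û + W û` on `[0, T]` with `û(0) = û₀`. -/
def SolvesCollocationODE {ι : Type*} [Fintype ι] (γ : ℝ) (D W : Matrix ι ι ℂ) (u₀ : ι → ℂ) (T : ℝ)
    (u : ℝ → ι → ℂ) : Prop :=
  u 0 = u₀ ∧ ∀ t ∈ Set.Icc 0 T, ∃ u' : ι → ℂ,
    HasDerivWithinAt u u' (Set.Icc 0 T) t ∧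
      (Complex.I * (γ : ℂ)) • u' = ((γ : ℂ) ^ 2 / 2) • (D *ᵥ u t) + W *ᵥ u t

/-- One Strang step:
`exp(-(i/(2γ)) Δt W) exp(-(iγ/2) Δt D) exp(-(i/(2γ)) Δt W)`. -/
def strangStep {ι : Type*} [Fintype ι] [DecidableEq ι] (γ Δt : ℝ) (D W : Matrix ι ι ℂ) :
    Matrix ι ι ℂ :=
  NormedSpace.exp ((-(Complex.I / (2 * (γ : ℂ))) * (Δt : ℂ)) • W) *
    NormedSpace.exp ((-(Complex.I * (γ : ℂ) / 2) * (Δt : ℂ)) • D) *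
    NormedSpace.exp ((-(Complex.I / (2 * (γ : ℂ))) * (Δt : ℂ)) • W)

/-- The Strang splitting iterates `û_a^{k+1} = S û_a^k`, started at `û_a^0 = û₀`. -/
def strangIterate {ι : Type*} [Fintype ι] [DecidableEq ι] (γ Δt : ℝ) (D W : Matrix ι ι ℂ)
    (u₀ : ι → ℂ) : ℕ → (ι → ℂ)
  | 0 => u₀
  | k + 1 => strangStep γ Δt D W *ᵥ strangIterate γ Δt D W u₀ k

/-- `‖f - g‖_{L₂(𝕋ᵈ)}`, as an extended nonnegative real. -/
def L2dist {d : ℕ} (f g : UnitAddTorus (Fin d) → ℂ) : ENNReal :=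
  eLpNorm (fun x => f x - g x) 2 (torusMeasure d)

end LatticeTDSE

end

open LatticeTDSE

/-! With `X = -i(γ/2)D_n` and `Y = -(i/(2γ))W_n` the collocated equation is `u' = (X + 2Y)u` and a
Strang step is `e^{sY} e^{sX} e^{sY}`, a product of unitary operators. The inverse of the step,
applied to the exact solution, moves with velocity
`(isometry) · R(s) e^{-sY} u(s)`, where the defect
`R(s) = (Y - e^{sX} Y e^{-sX}) + (e^{-sY} X e^{sY} - X)` satisfies `R(0) = R'(0) = 0`. Its first
derivative involves only the conjugated commutator `K = [X, Y]`, its second only `[X, K]` and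
`[Y, K]`. Hence the local error is `O(s²)` or `O(s³)` with constants that depend on relative bounds
of these commutators (`norm_strangDefect_apply_le_linear`,
`norm_strangDefect_apply_le_quadratic`), and telescoping gives the global error
(`norm_strangProp_pow_sub_le`). With `G = D + 1 = (γ/2)D_n + 1`, the commutators are bounded by
`‖G ·‖` and `‖G² ·‖` as soon as `Y` is bounded in the norms `‖Gᵐ ·‖` for `m ≤ 1` or `m ≤ 2`.

That this bound is uniform in the lattice rests on two facts. The discrete Fourier transform turns
multiplication by the character of frequency `l` into the shift `ξ ↦ ξ - Zᵀl` of the indices, so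
`W_n = ∑ v̂(l) · (shift by l)` (`hasSum_Wmat_mulVec`). Since each `h_ξ` is a shortest vector of its
class, `‖h_ξ‖ ≤ ‖h_{ξ - Zᵀl}‖ + ‖l‖` (`freqNorm_le_indexShift`), so that the shift by `l` is bounded
by a multiple of `(1 + ‖l‖²)ᵐ` in the norm `‖Gᵐ ·‖`. It remains to sum `|v̂(l)| (1 + ‖l‖²)ᵐ`, which by
Cauchy-Schwarz is finite for `2α - 4m > 1` (`summable_norm_mFourierCoeff_mul`): this is `α > 5/2` for
`m = 1` and `α > 9/2` for `m = 2`. -/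

noncomputable section

namespace LatticeTDSE

/-! ### One-parameter groups and conjugation -/

section Exponential

variable {𝔸 : Type*} [NormedRing 𝔸] [NormedAlgebra ℂ 𝔸]

lemma hasDerivAt_exp_ofReal_smul [CompleteSpace 𝔸] (X : 𝔸) (s : ℝ) :
    HasDerivAt (fun t : ℝ => NormedSpace.exp ((t : ℂ) • X))
      (X * NormedSpace.exp ((s : ℂ) • X)) s := by
  have h := (hasDerivAt_exp_smul_const' X (s : ℂ)).scomp s Complex.ofRealCLM.hasDerivAt
  simpa [Function.comp_def] using h

/-- The conjugation `e^{sX} C e^{-sX}` of `C` by the one-parameter group generated by `X`. -/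
def expConj (X C : 𝔸) (s : ℝ) : 𝔸 :=
  NormedSpace.exp ((s : ℂ) • X) * C * NormedSpace.exp ((s : ℂ) • -X)

lemma expConj_zero (X C : 𝔸) : expConj X C 0 = C := by
  simp [expConj]

lemma exp_mul_exp_neg [CompleteSpace 𝔸] (X : 𝔸) (s : ℝ) :
    NormedSpace.exp ((s : ℂ) • X) * NormedSpace.exp ((s : ℂ) • -X) = 1 := by
  let _ : NormedAlgebra ℚ 𝔸 := NormedAlgebra.restrictScalars ℚ ℂ 𝔸
  rw [smul_neg, ← NormedSpace.exp_add_of_commute (Commute.refl _).neg_right, add_neg_cancel,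
    NormedSpace.exp_zero]

lemma exp_neg_mul_exp [CompleteSpace 𝔸] (X : 𝔸) (s : ℝ) :
    NormedSpace.exp ((s : ℂ) • -X) * NormedSpace.exp ((s : ℂ) • X) = 1 := by
  simpa using exp_mul_exp_neg (-X) s

lemma commute_exp {G X : 𝔸} (h : Commute G X) (z : ℂ) :
    Commute G (NormedSpace.exp (z • X)) := by
  let _ : NormedAlgebra ℚ 𝔸 := NormedAlgebra.restrictScalars ℚ ℂ 𝔸
  exact (h.smul_right z).exp_right

lemma hasDerivAt_expConj [CompleteSpace 𝔸] (X C : 𝔸) (s : ℝ) :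
    HasDerivAt (expConj X C) (expConj X (X * C - C * X) s) s := by
  have h := ((hasDerivAt_exp_ofReal_smul X s).mul_const C).mul (hasDerivAt_exp_ofReal_smul (-X) s)
  refine h.congr_deriv ?_
  have e := (commute_exp (Commute.refl X) (s : ℂ)).eq
  simp only [expConj]
  rw [e]
  noncomm_ring

end Exponential

section Splitting

variable {E : Type*} [NormedAddCommGroup E] [InnerProductSpace ℂ E] [CompleteSpace E]

lemma norm_exp_apply_of_skew {X : E →L[ℂ] E} (hX : star X = -X) (s : ℝ) (y : E) :
    ‖NormedSpace.exp ((s : ℂ) • X) y‖ = ‖y‖ := by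
  let _ : NormedAlgebra ℚ (E →L[ℂ] E) := NormedAlgebra.restrictScalars ℚ ℂ _
  have h1 : (s : ℂ) • X ∈ skewAdjoint (E →L[ℂ] E) := by
    rw [skewAdjoint.mem_iff, star_smul, hX]
    simp
  have h2 := NormedSpace.exp_mem_unitary_of_mem_skewAdjoint h1
  exact ContinuousLinearMap.norm_map_of_mem_unitary h2 y

/-- If `Y` is bounded in the seminorm `y ↦ ‖H y‖`, the group it generates grows at most
exponentially there. -/
lemma norm_apply_exp_le {H Y : E →L[ℂ] E} {c : ℝ} (hHY : ∀ y, ‖H (Y y)‖ ≤ c * ‖H y‖)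
    {s : ℝ} (hs : 0 ≤ s) (y : E) :
    ‖H (NormedSpace.exp ((s : ℂ) • Y) y)‖ ≤ Real.exp (c * s) * ‖H y‖ := by
  have hd : ∀ t : ℝ, HasDerivAt (fun t : ℝ => H (NormedSpace.exp ((t : ℂ) • Y) y))
      (H (Y (NormedSpace.exp ((t : ℂ) • Y) y))) t := fun t => by
    have h1 := (ContinuousLinearMap.apply ℂ E y).hasFDerivAt.restrictScalars ℝ
      |>.comp_hasDerivAt t (hasDerivAt_exp_ofReal_smul Y t)
    exact (H.hasFDerivAt.restrictScalars ℝ).comp_hasDerivAt t h1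
  have := norm_le_gronwallBound_of_norm_deriv_right_le (δ := ‖H y‖) (K := c) (ε := 0)
    (a := 0) (b := s) (fun t _ => (hd t).continuousAt.continuousWithinAt)
    (fun t _ => (hd t).hasDerivWithinAt) (by simp) (fun t _ => by simpa using hHY _) s ⟨hs, le_rfl⟩
  rw [gronwallBound_ε0, sub_zero] at this
  linarith

end Splitting

/-! ### Error of Strang splitting in a Hilbert space -/

section Splitting

variable {E : Type*} [NormedAddCommGroup E] [InnerProductSpace ℂ E]

lemma hasDerivWithinAt_clm_apply {A : ℝ → E →L[ℂ] E} {A' : E →L[ℂ] E} {u : ℝ → E} {u' : E}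
    {S : Set ℝ} {s : ℝ} (hA : HasDerivWithinAt A A' S s) (hu : HasDerivWithinAt u u' S s) :
    HasDerivWithinAt (fun t => A t (u t)) (A' (u s) + A s u') S s := by
  have h1 : HasDerivWithinAt (fun t => ContinuousLinearMap.restrictScalarsL ℂ E E ℝ ℝ (A t))
      (ContinuousLinearMap.restrictScalarsL ℂ E E ℝ ℝ A') S s :=
    (ContinuousLinearMap.restrictScalarsL ℂ E E ℝ ℝ).hasFDerivAt.comp_hasDerivWithinAt s hA
  exact h1.clm_apply hu

lemma hasDerivAt_clm_apply_const {A : ℝ → E →L[ℂ] E} {A' : E →L[ℂ] E} {s : ℝ}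
    (hA : HasDerivAt A A' s) (z : E) : HasDerivAt (fun t => A t z) (A' z) s := by
  have h := hasDerivWithinAt_clm_apply hA.hasDerivWithinAt
    (hasDerivWithinAt_const s Set.univ z)
  simpa [hasDerivWithinAt_univ] using h

/-- The Strang propagator `e^{sY} e^{sX} e^{sY}` over time `s` for the generator `X + 2Y`. -/
def strangProp (X Y : E →L[ℂ] E) (s : ℝ) : E →L[ℂ] E :=
  NormedSpace.exp ((s : ℂ) • Y) * NormedSpace.exp ((s : ℂ) • X) * NormedSpace.exp ((s : ℂ) • Y)

/-- The defect of the Strang propagator. Up to the isometry `e^{-sY} e^{-sX}`, it is the velocity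
of `(e^{sY} e^{sX} e^{sY})⁻¹ u(s)` at `e^{-sY} u(s)`, if `u' = (X + 2Y) u`. -/
def strangDefect (X Y : E →L[ℂ] E) (s : ℝ) : E →L[ℂ] E :=
  (Y - expConj X Y s) + (expConj (-Y) X s - X)

lemma strangDefect_zero (X Y : E →L[ℂ] E) : strangDefect X Y 0 = 0 := by
  simp [strangDefect, expConj_zero]

/-- The algebra behind `hasDerivWithinAt_strangProp_neg_apply`, with `a = e^{-sY}`, `ai = e^{sY}`,
`b = e^{-sX}` and `bi = e^{sX}`. -/
lemma strangDefect_identity {R : Type*} [Ring R] {a ai b bi X Y : R} (ha : ai * a = 1)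
    (hb : b * bi = 1) (haY : Y * a = a * Y) (hbX : X * b = b * X) :
    ((-Y * a) * b + a * (-X * b)) * a + a * b * (-Y * a) + a * b * a * (X + Y + Y) =
      a * b * ((Y - bi * Y * b) + (a * X * ai - X)) * a := by
  have h1 : a * b * (bi * Y * b) * a = Y * a * b * a := by
    rw [haY]
    calc _ = a * (b * bi) * Y * b * a := by noncomm_ring
      _ = _ := by rw [hb]; noncomm_ring
  have h2 : a * b * (a * X * ai) * a = a * b * a * X := by
    calc _ = a * b * a * X * (ai * a) := by noncomm_ring
      _ = _ := by rw [ha, mul_one]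
  have h3 : a * b * X * a = a * (X * b) * a := by rw [hbX]; noncomm_ring
  have h4 : a * b * Y * a = a * b * a * Y := by
    rw [mul_assoc (a * b), haY]; noncomm_ring
  have h5 : a * b * ((Y - bi * Y * b) + (a * X * ai - X)) * a =
      a * b * Y * a - a * b * (bi * Y * b) * a + (a * b * (a * X * ai) * a - a * b * X * a) := by
    noncomm_ring
  have h6 : a * b * (Y * a) = a * b * a * Y := by rw [← h4]; noncomm_ring
  rw [h5, h1, h2, h3, h4]
  have h7 : ((-Y * a) * b + a * (-X * b)) * a + a * b * (-Y * a) + a * b * a * (X + Y + Y) =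
     - (Y * a * b * a) - a * (X * b) * a - a * b * (Y * a) + a * b * a * X + a * b * a * Y
      + a * b * a * Y := by noncomm_ring
  rw [h7, h6]
  abel

/-- Telescoping: the global error of an isometric one-step method is at most the sum of its local
errors. -/
lemma norm_iterate_sub_le {S : E →L[ℂ] E} (hS : ∀ y, ‖S y‖ = ‖y‖) {U : ℕ → E} {ε : ℝ} {k : ℕ}
    (h : ∀ j < k, ‖S (U j) - U (j + 1)‖ ≤ ε) : ‖(S ^ k) (U 0) - U k‖ ≤ k * ε := by
  induction k with
  | zero => simp
  | succ k ih =>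
    have e : (S ^ (k + 1)) (U 0) - U (k + 1) =
        S ((S ^ k) (U 0) - U k) + (S (U k) - U (k + 1)) := by
      rw [pow_succ', mul_apply_eq_comp, map_sub]
      abel
    rw [e]
    refine (norm_add_le _ _).trans ?_
    rw [hS]
    have := ih fun j hj => h j (by omega)
    have := h k (by omega)
    rw [Nat.cast_succ]
    linarith

variable [CompleteSpace E]

lemma norm_strangProp_apply {X Y : E →L[ℂ] E} (hX : star X = -X) (hY : star Y = -Y) (s : ℝ)
    (y : E) : ‖strangProp X Y s y‖ = ‖y‖ := by
  simp only [strangProp, mul_apply_eq_comp, norm_exp_apply_of_skew hX,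
    norm_exp_apply_of_skew hY]

lemma strangProp_mul_neg (X Y : E →L[ℂ] E) (s : ℝ) :
    strangProp X Y s * strangProp (-X) (-Y) s = 1 := by
  simp only [strangProp]
  calc _ = NormedSpace.exp ((s : ℂ) • Y) * (NormedSpace.exp ((s : ℂ) • X) *
        (NormedSpace.exp ((s : ℂ) • Y) * NormedSpace.exp ((s : ℂ) • -Y)) *
        NormedSpace.exp ((s : ℂ) • -X)) * NormedSpace.exp ((s : ℂ) • -Y) := by
        simp only [mul_assoc]
    _ = 1 := by rw [exp_mul_exp_neg, mul_one, exp_mul_exp_neg, mul_one, exp_mul_exp_neg]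

/-- The inverse Strang propagator, applied to an exact solution, moves with the velocity given by
the defect. -/
lemma hasDerivWithinAt_strangProp_neg_apply (X Y : E →L[ℂ] E) {u : ℝ → E} {S : Set ℝ} {s : ℝ}
    (hu : HasDerivWithinAt u ((X + Y + Y) (u s)) S s) :
    HasDerivWithinAt (fun t => strangProp (-X) (-Y) t (u t))
      (NormedSpace.exp ((s : ℂ) • -Y) (NormedSpace.exp ((s : ℂ) • -X)
        (strangDefect X Y s (NormedSpace.exp ((s : ℂ) • -Y) (u s))))) S s := by
  have h := (((hasDerivAt_exp_ofReal_smul (-Y) s).mul (hasDerivAt_exp_ofReal_smul (-X) s)).mul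
    (hasDerivAt_exp_ofReal_smul (-Y) s)).hasDerivWithinAt (s := S)
  have h2 := hasDerivWithinAt_clm_apply h hu
  refine h2.congr_deriv ?_
  have key := strangDefect_identity (X := X) (Y := Y) (exp_mul_exp_neg Y s) (exp_neg_mul_exp X s)
    (commute_exp (Commute.refl Y).neg_right (s : ℂ)).eq
    (commute_exp (Commute.refl X).neg_right (s : ℂ)).eq
  have := congrArg (fun L : E →L[ℂ] E => L (u s)) key
  simpa [strangDefect, expConj] using this

/-- The local error of a Strang step is controlled by the defect along the exact solution. -/
lemma norm_strangProp_sub_le {X Y : E →L[ℂ] E} (hX : star X = -X) (hY : star Y = -Y) {u : ℝ → E}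
    {τ δ : ℝ} (hτ : 0 ≤ τ)
    (hu : ∀ s ∈ Set.Icc 0 τ, HasDerivWithinAt u ((X + Y + Y) (u s)) (Set.Icc 0 τ) s)
    (hδ : ∀ s ∈ Set.Icc 0 τ, ‖strangDefect X Y s (NormedSpace.exp ((s : ℂ) • -Y) (u s))‖ ≤ δ) :
    ‖strangProp X Y τ (u 0) - u τ‖ ≤ δ * τ := by
  have hX' : star (-X) = - -X := by rw [star_neg, hX]
  have hY' : star (-Y) = - -Y := by rw [star_neg, hY]
  have h := norm_image_sub_le_of_norm_deriv_le_segment'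
    (fun s hs => hasDerivWithinAt_strangProp_neg_apply X Y (hu s hs))
    (fun s hs => by
      rw [norm_exp_apply_of_skew hY', norm_exp_apply_of_skew hX']
      exact hδ s ⟨hs.1, hs.2.le⟩) τ ⟨hτ, le_rfl⟩
  have h0 : strangProp (-X) (-Y) 0 (u 0) = u 0 := by simp [strangProp]
  have h1 : strangProp X Y τ (strangProp (-X) (-Y) τ (u τ)) = u τ := by
    rw [← mul_apply_eq_comp, strangProp_mul_neg, one_apply_eq_self]
  rw [h0, sub_zero, norm_sub_rev, ← norm_strangProp_apply hX hY τ, map_sub, h1] at h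
  exact h

lemma norm_expConj_apply_le_of_commute {X C H : E →L[ℂ] E} {κ : ℝ} (hX : star X = -X)
    (hH : Commute H X) (hC : ∀ y, ‖C y‖ ≤ κ * ‖H y‖) (s : ℝ) (z : E) :
    ‖expConj X C s z‖ ≤ κ * ‖H z‖ := by
  have hX' : star (-X) = - -X := by rw [star_neg, hX]
  have e : H (NormedSpace.exp ((s : ℂ) • -X) z) = NormedSpace.exp ((s : ℂ) • -X) (H z) :=
    congrArg (fun L : E →L[ℂ] E => L z) (commute_exp hH.neg_right (s : ℂ)).eq
  simp only [expConj, mul_apply_eq_comp, norm_exp_apply_of_skew hX]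
  refine (hC _).trans_eq ?_
  rw [e, norm_exp_apply_of_skew hX']

lemma norm_expConj_apply_le_of_bounded {Y C H : E →L[ℂ] E} {κ c : ℝ} (hκ : 0 ≤ κ) (hc : 0 ≤ c)
    (hY : star Y = -Y) (hHY : ∀ y, ‖H (Y y)‖ ≤ c * ‖H y‖) (hC : ∀ y, ‖C y‖ ≤ κ * ‖H y‖)
    {s : ℝ} (hs : s ∈ Set.Icc (0 : ℝ) 1) (z : E) :
    ‖expConj (-Y) C s z‖ ≤ κ * Real.exp c * ‖H z‖ := by
  have hY' : star (-Y) = - -Y := by rw [star_neg, hY]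
  simp only [expConj, mul_apply_eq_comp, norm_exp_apply_of_skew hY', neg_neg]
  refine (hC _).trans ?_
  rw [mul_assoc]
  have : Real.exp (c * s) ≤ Real.exp c := Real.exp_le_exp.2 (mul_le_of_le_one_right hc hs.2)
  gcongr
  exact (norm_apply_exp_le hHY hs.1 z).trans (by gcongr)

/-- The derivative of the defect, in terms of the commutator `K = [X, Y]`. -/
lemma hasDerivAt_strangDefect (X Y : E →L[ℂ] E) (s : ℝ) :
    HasDerivAt (strangDefect X Y)
      (expConj (-Y) (X * Y - Y * X) s - expConj X (X * Y - Y * X) s) s := by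
  have h := ((hasDerivAt_expConj X Y s).const_sub Y).add
    ((hasDerivAt_expConj (-Y) X s).sub_const X)
  refine h.congr_deriv ?_
  rw [show -Y * X - X * -Y = X * Y - Y * X by noncomm_ring]
  abel

lemma norm_strangDefect_apply_le_linear {X Y H : E →L[ℂ] E} {κ c : ℝ} (hκ : 0 ≤ κ) (hc : 0 ≤ c)
    (hX : star X = -X) (hY : star Y = -Y) (hH : Commute H X)
    (hHY : ∀ y, ‖H (Y y)‖ ≤ c * ‖H y‖) (hK : ∀ y, ‖(X * Y - Y * X) y‖ ≤ κ * ‖H y‖)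
    {s : ℝ} (hs : s ∈ Set.Icc (0 : ℝ) 1) (z : E) :
    ‖strangDefect X Y s z‖ ≤ (κ * Real.exp c + κ) * ‖H z‖ * s := by
  have h := norm_image_sub_le_of_norm_deriv_le_segment' (a := 0) (b := s)
    (C := (κ * Real.exp c + κ) * ‖H z‖)
    (fun t _ => (hasDerivAt_clm_apply_const (hasDerivAt_strangDefect X Y t) z).hasDerivWithinAt)
    (fun t ht => by
      rw [_root_.sub_apply, add_mul]
      exact (norm_sub_le _ _).trans (add_le_add
        (norm_expConj_apply_le_of_bounded hκ hc hY hHY hK ⟨ht.1, ht.2.le.trans hs.2⟩ z)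
        (norm_expConj_apply_le_of_commute hX hH hK t z))) s ⟨hs.1, le_rfl⟩
  simpa [strangDefect_zero] using h

/-- The derivative of the defect vanishes at `0` as well, so that bounds on the double commutators
give a quadratic estimate. -/
lemma norm_strangDefect_apply_le_quadratic {X Y H : E →L[ℂ] E} {κ₁ κ₂ c : ℝ} (hκ₁ : 0 ≤ κ₁)
    (hκ₂ : 0 ≤ κ₂) (hc : 0 ≤ c) (hX : star X = -X) (hY : star Y = -Y) (hH : Commute H X)
    (hHY : ∀ y, ‖H (Y y)‖ ≤ c * ‖H y‖)
    (hK₁ : ∀ y, ‖(X * (X * Y - Y * X) - (X * Y - Y * X) * X) y‖ ≤ κ₁ * ‖H y‖)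
    (hK₂ : ∀ y, ‖(-Y * (X * Y - Y * X) - (X * Y - Y * X) * -Y) y‖ ≤ κ₂ * ‖H y‖)
    {s : ℝ} (hs : s ∈ Set.Icc (0 : ℝ) 1) (z : E) :
    ‖strangDefect X Y s z‖ ≤ (κ₂ * Real.exp c + κ₁) * ‖H z‖ * s ^ 2 := by
  set K := X * Y - Y * X with hKdef
  have h1 : ∀ t ∈ Set.Icc (0 : ℝ) s, ‖(expConj (-Y) K t - expConj X K t) z‖ ≤
      (κ₂ * Real.exp c + κ₁) * ‖H z‖ * t := fun t ht => by
    have h := norm_image_sub_le_of_norm_deriv_le_segment' (a := 0) (b := t)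
      (C := (κ₂ * Real.exp c + κ₁) * ‖H z‖)
      (fun r _ => (hasDerivAt_clm_apply_const
        ((hasDerivAt_expConj (-Y) K r).sub (hasDerivAt_expConj X K r)) z).hasDerivWithinAt)
      (fun r hr => by
        rw [_root_.sub_apply, add_mul]
        exact (norm_sub_le _ _).trans (add_le_add
          (norm_expConj_apply_le_of_bounded hκ₂ hc hY hHY hK₂
            ⟨hr.1, hr.2.le.trans (ht.2.trans hs.2)⟩ z)
          (norm_expConj_apply_le_of_commute hX hH hK₁ r z))) t ⟨ht.1, le_rfl⟩
    simpa [expConj_zero] using h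
  have h := norm_image_sub_le_of_norm_deriv_le_segment' (a := 0) (b := s)
    (C := (κ₂ * Real.exp c + κ₁) * ‖H z‖ * s)
    (fun t _ => (hasDerivAt_clm_apply_const (hasDerivAt_strangDefect X Y t) z).hasDerivWithinAt)
    (fun t ht => (h1 t ⟨ht.1, ht.2.le⟩).trans (by gcongr; exact ht.2.le)) s ⟨hs.1, le_rfl⟩
  rw [strangDefect_zero, _root_.zero_apply, sub_zero, sub_zero] at h
  rw [pow_two, ← mul_assoc]
  exact h

/-- A local error bound of order `p + 1`, valid for steps of any length `τ`: the factor `e^c` only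
covers `τ ≤ 1`, and for `τ > 1` both terms of the error are at most `M`. -/
lemma norm_strangProp_sub_le_pow {X Y H : E →L[ℂ] E} {c L M τ : ℝ} {p : ℕ}
    (hc : 0 ≤ c) (hL : 0 ≤ L)
    (hX : star X = -X) (hY : star Y = -Y) (hH0 : ∀ y, ‖y‖ ≤ ‖H y‖)
    (hHY : ∀ y, ‖H (Y y)‖ ≤ c * ‖H y‖)
    (hdef : ∀ s ∈ Set.Icc (0 : ℝ) 1, ∀ z, ‖strangDefect X Y s z‖ ≤ L * ‖H z‖ * s ^ p)
    (hτ : 0 < τ) {u : ℝ → E}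
    (hu : ∀ s ∈ Set.Icc 0 τ, HasDerivWithinAt u ((X + Y + Y) (u s)) (Set.Icc 0 τ) s)
    (hM : ∀ s ∈ Set.Icc 0 τ, ‖H (u s)‖ ≤ M) :
    ‖strangProp X Y τ (u 0) - u τ‖ ≤ (L * Real.exp c + 2) * M * τ ^ p * τ := by
  have hM0 : 0 ≤ M := (norm_nonneg _).trans (hM 0 ⟨le_rfl, hτ.le⟩)
  rcases le_or_gt τ 1 with h1 | h1
  · have hHY' : ∀ y, ‖H (-Y y)‖ ≤ c * ‖H y‖ := fun y => by simpa using hHY y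
    refine (norm_strangProp_sub_le hX hY hτ.le hu (δ := L * (Real.exp c * M) * τ ^ p) ?_).trans ?_
    · intro s hs
      have hs1 : s ∈ Set.Icc (0 : ℝ) 1 := ⟨hs.1, hs.2.trans h1⟩
      have hz := norm_apply_exp_le (H := H) (Y := -Y) hHY' hs.1 (u s)
      have he : Real.exp (c * s) ≤ Real.exp c :=
        Real.exp_le_exp.2 (mul_le_of_le_one_right hc hs1.2)
      have hs0 := hs.1
      have hs2 := hs.2
      refine (hdef s hs1 _).trans ?_
      gcongr
      exact hz.trans (by gcongr; exact hM s hs)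
    · have : 0 ≤ 2 * M * τ ^ p * τ := by positivity
      nlinarith
  · have hb : ∀ s ∈ Set.Icc 0 τ, ‖u s‖ ≤ M := fun s hs => (hH0 _).trans (hM s hs)
    have h2 : ‖strangProp X Y τ (u 0) - u τ‖ ≤ 2 * M := by
      refine (norm_sub_le _ _).trans ?_
      rw [norm_strangProp_apply hX hY]
      linarith [hb 0 ⟨le_rfl, hτ.le⟩, hb τ ⟨hτ.le, le_rfl⟩]
    refine h2.trans ?_
    have h3 : 1 ≤ τ ^ p * τ := one_le_mul_of_one_le_of_one_le (one_le_pow₀ h1.le) h1.le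
    have h4 : 0 ≤ L * Real.exp c * M := by positivity
    rw [mul_assoc]
    nlinarith

lemma norm_strangProp_pow_sub_le {X Y H : E →L[ℂ] E} {c L M τ T : ℝ} {p k : ℕ}
    (hc : 0 ≤ c) (hL : 0 ≤ L)
    (hX : star X = -X) (hY : star Y = -Y) (hH0 : ∀ y, ‖y‖ ≤ ‖H y‖)
    (hHY : ∀ y, ‖H (Y y)‖ ≤ c * ‖H y‖)
    (hdef : ∀ s ∈ Set.Icc (0 : ℝ) 1, ∀ z, ‖strangDefect X Y s z‖ ≤ L * ‖H z‖ * s ^ p)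
    (hτ : 0 < τ) (hkT : k * τ ≤ T) {u : ℝ → E}
    (hu : ∀ s ∈ Set.Icc 0 T, HasDerivWithinAt u ((X + Y + Y) (u s)) (Set.Icc 0 T) s)
    (hM : ∀ s ∈ Set.Icc 0 (k * τ), ‖H (u s)‖ ≤ M) :
    ‖(strangProp X Y τ ^ k) (u 0) - u (k * τ)‖ ≤
      τ ^ p * (L * Real.exp c + 2) * (k * τ) * M := by
  have h := norm_iterate_sub_le (S := strangProp X Y τ) (norm_strangProp_apply hX hY τ)
    (U := fun j : ℕ => u (j * τ)) (ε := (L * Real.exp c + 2) * M * τ ^ p * τ) (k := k) ?_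
  · simp only [Nat.cast_zero, zero_mul] at h
    exact h.trans_eq (by ring)
  intro j hj
  have hj1 : ((j : ℝ) + 1) ≤ k := by exact_mod_cast hj
  have hmaps : ∀ s ∈ Set.Icc 0 τ, j * τ + s ∈ Set.Icc 0 (k * τ) := fun s hs => by
    have : ((j : ℝ) + 1) * τ ≤ k * τ := by gcongr
    exact ⟨by have := hs.1; positivity, by nlinarith [hs.2]⟩
  have hloc := norm_strangProp_sub_le_pow hc hL hX hY hH0 hHY hdef hτ
    (u := fun s => u (j * τ + s)) (M := M) (fun s hs => ?_) (fun s hs => hM _ (hmaps s hs))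
  · simp only [add_zero] at hloc
    have e : ((j + 1 : ℕ) : ℝ) * τ = j * τ + τ := by push_cast; ring
    simpa only [e] using hloc
  · have hmem := hmaps s hs
    have h1 := hu _ ⟨hmem.1, hmem.2.trans hkT⟩
    have h2 : HasDerivWithinAt (fun s : ℝ => j * τ + s) 1 (Set.Icc 0 τ) s :=
      (hasDerivWithinAt_id s _).const_add _
    have h3 := h1.scomp s h2 (fun r hr => ⟨(hmaps r hr).1, (hmaps r hr).2.trans hkT⟩)
    simpa [Function.comp_def] using h3

/-- First-order convergence of Strang splitting: if `Y` is bounded in the norms `‖·‖` and `‖G ·‖`,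
and `X` is relatively bounded by `G`, which commutes with `X`. -/
theorem norm_strangProp_pow_sub_le_first {X Y G : E →L[ℂ] E} {c M τ T : ℝ} {k : ℕ}
    (hc : 0 ≤ c) (hX : star X = -X) (hY : star Y = -Y) (hG : Commute G X)
    (hG0 : ∀ y, ‖y‖ ≤ ‖G y‖) (hGX : ∀ y, ‖X y‖ ≤ ‖G y‖)
    (hY0 : ∀ y, ‖Y y‖ ≤ c * ‖y‖) (hY1 : ∀ y, ‖G (Y y)‖ ≤ c * ‖G y‖)
    (hτ : 0 < τ) (hkT : k * τ ≤ T) {u : ℝ → E}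
    (hu : ∀ s ∈ Set.Icc 0 T, HasDerivWithinAt u ((X + Y + Y) (u s)) (Set.Icc 0 T) s)
    (hM : ∀ s ∈ Set.Icc 0 (k * τ), ‖G (u s)‖ ≤ M) :
    ‖(strangProp X Y τ ^ k) (u 0) - u (k * τ)‖ ≤
      τ * ((2 * c * Real.exp c + 2 * c) * Real.exp c + 2) * (k * τ) * M := by
  have hK : ∀ y, ‖(X * Y - Y * X) y‖ ≤ 2 * c * ‖G y‖ := fun y => by
    simp only [_root_.sub_apply, mul_apply_eq_comp]
    have h1 := (hGX (Y y)).trans (hY1 y)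
    have h2 := (hY0 (X y)).trans (mul_le_mul_of_nonneg_left (hGX y) hc)
    linarith [norm_sub_le (X (Y y)) (Y (X y))]
  have h := norm_strangProp_pow_sub_le (p := 1) (L := 2 * c * Real.exp c + 2 * c) hc
    (by positivity) hX hY hG0 hY1
    (fun s hs z => by
      simpa using norm_strangDefect_apply_le_linear (by positivity) hc hX hY hG hY1 hK hs z)
    hτ hkT hu hM
  simpa using h

/-- Second-order convergence of Strang splitting: if `Y` is bounded in the norms `‖·‖`, `‖G ·‖`
and `‖G² ·‖`, and `X` is relatively bounded by `G`, which commutes with `X`. -/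
theorem norm_strangProp_pow_sub_le_second {X Y G : E →L[ℂ] E} {c M τ T : ℝ} {k : ℕ}
    (hc : 0 ≤ c) (hX : star X = -X) (hY : star Y = -Y) (hG : Commute G X)
    (hG0 : ∀ y, ‖y‖ ≤ ‖G y‖) (hGX : ∀ y, ‖X y‖ ≤ ‖G y‖)
    (hY0 : ∀ y, ‖Y y‖ ≤ c * ‖y‖) (hY1 : ∀ y, ‖G (Y y)‖ ≤ c * ‖G y‖)
    (hY2 : ∀ y, ‖(G ^ 2) (Y y)‖ ≤ c * ‖(G ^ 2) y‖)
    (hτ : 0 < τ) (hkT : k * τ ≤ T) {u : ℝ → E}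
    (hu : ∀ s ∈ Set.Icc 0 T, HasDerivWithinAt u ((X + Y + Y) (u s)) (Set.Icc 0 T) s)
    (hM : ∀ s ∈ Set.Icc 0 (k * τ), ‖(G ^ 2) (u s)‖ ≤ M) :
    ‖(strangProp X Y τ ^ k) (u 0) - u (k * τ)‖ ≤
      τ ^ 2 * ((4 * c ^ 2 * Real.exp c + 4 * c) * Real.exp c + 2) * (k * τ) * M := by
  have hG2 : ∀ y, (G ^ 2) y = G (G y) := fun y => by
    rw [pow_two, mul_apply_eq_comp]
  have hcomm : ∀ y, G (X y) = X (G y) := fun y =>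
    congrArg (fun L : E →L[ℂ] E => L y) hG.eq
  have hGX1 : ∀ y, ‖G (X y)‖ ≤ ‖(G ^ 2) y‖ := fun y => by rw [hcomm, hG2]; exact hGX _
  have hXX : ∀ y, ‖X (X y)‖ ≤ ‖(G ^ 2) y‖ := fun y => (hGX _).trans (hGX1 y)
  have hG12 : ∀ y, ‖G y‖ ≤ ‖(G ^ 2) y‖ := fun y => by rw [hG2]; exact hG0 _
  have hK₁ : ∀ y, ‖(X * (X * Y - Y * X) - (X * Y - Y * X) * X) y‖ ≤ 4 * c * ‖(G ^ 2) y‖ := by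
    intro y
    have e : (X * (X * Y - Y * X) - (X * Y - Y * X) * X) y =
        X (X (Y y)) - X (Y (X y)) - (X (Y (X y)) - Y (X (X y))) := by
      simp only [_root_.sub_apply, mul_apply_eq_comp, map_sub]
    rw [e]
    have h1 := (hXX (Y y)).trans (hY2 y)
    have h2 := ((hGX (Y (X y))).trans (hY1 (X y))).trans (mul_le_mul_of_nonneg_left (hGX1 y) hc)
    have h3 := (hY0 (X (X y))).trans (mul_le_mul_of_nonneg_left (hXX y) hc)
    linarith [norm_sub_le (X (X (Y y)) - X (Y (X y))) (X (Y (X y)) - Y (X (X y))),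
      norm_sub_le (X (X (Y y))) (X (Y (X y))), norm_sub_le (X (Y (X y))) (Y (X (X y)))]
  have hK₂ : ∀ y, ‖(-Y * (X * Y - Y * X) - (X * Y - Y * X) * -Y) y‖ ≤
      4 * c ^ 2 * ‖(G ^ 2) y‖ := by
    intro y
    have e : (-Y * (X * Y - Y * X) - (X * Y - Y * X) * -Y) y =
        (X (Y (Y y)) - Y (X (Y y))) - (Y (X (Y y)) - Y (Y (X y))) := by
      simp only [_root_.sub_apply, mul_apply_eq_comp, map_sub,
        _root_.neg_apply, map_neg]
      abel
    rw [e]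
    have h0 := mul_le_mul_of_nonneg_left (mul_le_mul_of_nonneg_left (hG12 y) hc) hc
    have h1 : ‖X (Y (Y y))‖ ≤ c * (c * ‖G y‖) :=
      ((hGX _).trans (hY1 _)).trans (mul_le_mul_of_nonneg_left (hY1 y) hc)
    have h2 : ‖Y (X (Y y))‖ ≤ c * (c * ‖G y‖) :=
      (hY0 _).trans (mul_le_mul_of_nonneg_left ((hGX _).trans (hY1 y)) hc)
    have h3 : ‖Y (Y (X y))‖ ≤ c * (c * ‖G y‖) :=
      (hY0 _).trans (mul_le_mul_of_nonneg_left
        ((hY0 _).trans (mul_le_mul_of_nonneg_left (hGX y) hc)) hc)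
    linarith [norm_sub_le (X (Y (Y y)) - Y (X (Y y))) (Y (X (Y y)) - Y (Y (X y))),
      norm_sub_le (X (Y (Y y))) (Y (X (Y y))), norm_sub_le (Y (X (Y y))) (Y (Y (X y)))]
  exact norm_strangProp_pow_sub_le (p := 2) (L := 4 * c ^ 2 * Real.exp c + 4 * c) hc
    (by positivity) hX hY (fun y => (hG0 y).trans (hG12 y)) hY2
    (fun s hs z => norm_strangDefect_apply_le_quadratic (by positivity) (by positivity) hc hX hY
      (hG.pow_left 2) hY2 hK₁ hK₂ hs z) hτ hkT hu hM

end Splitting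

/-! ### Norms of coefficient and frequency vectors -/

lemma l2norm_sq {ι : Type*} [Fintype ι] (y : ι → ℂ) : l2norm y ^ 2 = ∑ i, ‖y i‖ ^ 2 := by
  simp [l2norm, EuclideanSpace.norm_sq_eq]

lemma l2norm_le_l2norm {ι : Type*} [Fintype ι] {a b : ι → ℂ} (h : ∀ ξ, ‖a ξ‖ ≤ ‖b ξ‖) : l2norm a ≤ l2norm b := by
  refine (sq_le_sq₀ (norm_nonneg _) (norm_nonneg _)).1 ?_
  change l2norm a ^ 2 ≤ l2norm b ^ 2
  rw [l2norm_sq, l2norm_sq]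
  gcongr with ξ
  exact h ξ

lemma l2norm_smul {ι : Type*} [Fintype ι] (c : ℂ) (a : ι → ℂ) : l2norm (c • a) = ‖c‖ * l2norm a := by
  rw [l2norm, WithLp.toLp_smul, norm_smul, l2norm]

lemma freqNorm_sq {d : ℕ} (h : Fin d → ℤ) : freqNorm h ^ 2 = ∑ i, (h i : ℝ) ^ 2 := by
  simp [freqNorm, EuclideanSpace.norm_sq_eq]

lemma freqNorm_nonneg {d : ℕ} (h : Fin d → ℤ) : 0 ≤ freqNorm h := norm_nonneg _

lemma freqNorm_add_le {d : ℕ} (h l : Fin d → ℤ) : freqNorm (h + l) ≤ freqNorm h + freqNorm l := by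
  have e : (WithLp.toLp 2 fun i => ((h + l) i : ℝ) : EuclideanSpace ℝ (Fin d)) =
      WithLp.toLp 2 (fun i => (h i : ℝ)) + WithLp.toLp 2 (fun i => (l i : ℝ)) := by
    ext i
    simp
  rw [freqNorm, e]
  exact norm_add_le _ _

/-! ### The discrete Fourier matrix and index shifts -/

section DFT

lemma sum_dft_factor {m : ℕ} (hm : 0 < m) (x y : Fin m) :
    ∑ k : Fin m, (((Real.sqrt m : ℝ) : ℂ)⁻¹ *
      Complex.exp (-2 * Real.pi * Complex.I * ((k : ℕ) : ℂ) * ((x : ℕ) : ℂ) / (m : ℂ))) *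
      star (((Real.sqrt m : ℝ) : ℂ)⁻¹ *
      Complex.exp (-2 * Real.pi * Complex.I * ((k : ℕ) : ℂ) * ((y : ℕ) : ℂ) / (m : ℂ))) =
      if x = y then 1 else 0 := by
  have hm' : (m : ℂ) ≠ 0 := by exact_mod_cast hm.ne'
  have hs : ((Real.sqrt m : ℝ) : ℂ)⁻¹ * ((Real.sqrt m : ℝ) : ℂ)⁻¹ = (m : ℂ)⁻¹ := by
    rw [← mul_inv, ← Complex.ofReal_mul, Real.mul_self_sqrt (Nat.cast_nonneg m)]
    simp
  set w : ℂ := Complex.exp (2 * Real.pi * Complex.I * (((y : ℕ) : ℂ) - ((x : ℕ) : ℂ)) / m) with hw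
  have hterm : ∀ k : Fin m, (((Real.sqrt m : ℝ) : ℂ)⁻¹ *
      Complex.exp (-2 * Real.pi * Complex.I * ((k : ℕ) : ℂ) * ((x : ℕ) : ℂ) / (m : ℂ))) *
      star (((Real.sqrt m : ℝ) : ℂ)⁻¹ *
      Complex.exp (-2 * Real.pi * Complex.I * ((k : ℕ) : ℂ) * ((y : ℕ) : ℂ) / (m : ℂ))) =
      (m : ℂ)⁻¹ * w ^ (k : ℕ) := by
    intro k
    rw [star_mul', Complex.star_def, ← Complex.exp_conj, map_inv₀,
      Complex.conj_ofReal, mul_mul_mul_comm, hs, ← Complex.exp_add, hw, ← Complex.exp_nat_mul]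
    congr 2
    simp only [map_div₀, map_mul, map_neg, map_ofNat, map_natCast, Complex.conj_ofReal,
      Complex.conj_I]
    ring
  rw [Finset.sum_congr rfl fun k _ => hterm k, ← Finset.mul_sum,
    Fin.sum_univ_eq_sum_range fun k => w ^ k]
  split_ifs with hxy
  · have : w = 1 := by simp [hw, hxy]
    simp [this, hm']
  · have hw1 : w ≠ 1 := by
      intro h1
      obtain ⟨q, hq⟩ := Complex.exp_eq_one_iff.1 (hw ▸ h1)
      have hq' : (((y : ℕ) : ℂ) - ((x : ℕ) : ℂ)) = q * m := by
        have := Complex.two_pi_I_ne_zero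
        field_simp at hq
        linear_combination hq
      have hq2 : ((y : ℕ) : ℤ) - ((x : ℕ) : ℤ) = q * m := by exact_mod_cast hq'
      have hx := x.2
      have hy := y.2
      have hq0 : q = 0 := by
        rcases lt_trichotomy q 0 with h | h | h
        · nlinarith
        · exact h
        · nlinarith
      apply hxy
      ext
      rw [hq0] at hq2
      omega
    have hwm : w ^ m = 1 := by
      rw [hw, ← Complex.exp_nat_mul, Complex.exp_eq_one_iff]
      refine ⟨((y : ℕ) : ℤ) - ((x : ℕ) : ℤ), ?_⟩
      push_cast
      field_simp
    rw [geom_sum_eq hw1, hwm]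
    simp

variable {r : ℕ} {n : Fin r → ℕ}

lemma dftMatrix_mul_conjTranspose (hn : ∀ j, 0 < n j) :
    dftMatrix n * (dftMatrix n)ᴴ = 1 := by
  ext ξ η
  rw [Matrix.mul_apply]
  simp only [Matrix.conjTranspose_apply, dftMatrix, Matrix.of_apply]
  simp only [star_prod, ← Finset.prod_mul_distrib]
  have h := Finset.prod_univ_sum (fun j : Fin r => (Finset.univ : Finset (Fin (n j))))
    (fun j k => (((Real.sqrt (n j) : ℝ) : ℂ)⁻¹ *
      Complex.exp (-2 * Real.pi * Complex.I * ((k : ℕ) : ℂ) * ((ξ j : ℕ) : ℂ) / (n j : ℂ))) *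
      star (((Real.sqrt (n j) : ℝ) : ℂ)⁻¹ *
      Complex.exp (-2 * Real.pi * Complex.I * ((k : ℕ) : ℂ) * ((η j : ℕ) : ℂ) / (n j : ℂ))))
  rw [Fintype.piFinset_univ] at h
  rw [← h, Finset.prod_congr rfl fun j _ => sum_dft_factor (hn j) (ξ j) (η j), Matrix.one_apply]
  by_cases hξ : ξ = η
  · simp [hξ]
  · obtain ⟨j, hj⟩ := Function.ne_iff.1 hξ
    rw [if_neg hξ]
    exact Finset.prod_eq_zero (Finset.mem_univ j) (if_neg hj)

lemma dftMatrix_inv (hn : ∀ j, 0 < n j) : (dftMatrix n)⁻¹ = (dftMatrix n)ᴴ :=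
  Matrix.inv_eq_right_inv (dftMatrix_mul_conjTranspose hn)

lemma dftMatrix_mul_inv (hn : ∀ j, 0 < n j) : dftMatrix n * (dftMatrix n)⁻¹ = 1 := by
  rw [dftMatrix_inv hn, dftMatrix_mul_conjTranspose hn]

variable {d : ℕ}

lemma Wmat_isHermitian (Z : Matrix (Fin d) (Fin r) ℤ) (hn : ∀ j, 0 < n j)
    (v : UnitAddTorus (Fin d) → ℝ) : (Wmat Z n v).IsHermitian := by
  have hV : (potentialMatrix Z n v).IsHermitian := by
    rw [potentialMatrix, Matrix.isHermitian_diagonal_iff]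
    intro k
    exact Complex.conj_ofReal _
  rw [Wmat, dftMatrix_inv hn]
  exact Matrix.isHermitian_mul_mul_conjTranspose _ hV

lemma mFourier_latticePoint (Z : Matrix (Fin d) (Fin r) ℤ) (n : Fin r → ℕ) (l : Fin d → ℤ)
    (k : MultiIndex n) :
    UnitAddTorus.mFourier l (latticePoint Z n k) = ∏ j,
      Complex.exp (2 * Real.pi * Complex.I * ((k j : ℕ) : ℂ) * (((Zᵀ *ᵥ l) j : ℤ) : ℂ) /
        (n j : ℂ)) := by
  simp only [UnitAddTorus.mFourier, ContinuousMap.coe_mk, latticePoint, fourier_coe_apply]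
  rw [← Complex.exp_sum, ← Complex.exp_sum]
  congr 1
  simp only [Matrix.mulVec, dotProduct, Matrix.transpose_apply]
  push_cast
  simp only [Finset.mul_sum, Finset.sum_div]
  rw [Finset.sum_comm]
  refine Finset.sum_congr rfl fun j _ => Finset.sum_congr rfl fun i _ => ?_
  ring

/-- The shift `ξ ↦ (ξ - Zᵀ l) mod n` of the multi-indices. -/
def indexShift (Z : Matrix (Fin d) (Fin r) ℤ) (hn : ∀ j, 0 < n j) (l : Fin d → ℤ)
    (ξ : MultiIndex n) : MultiIndex n := fun j =>
  ⟨((((ξ j : ℕ) : ℤ) - (Zᵀ *ᵥ l) j) % (n j : ℤ)).toNat, by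
    have h0 : (0 : ℤ) < n j := by exact_mod_cast hn j
    have := Int.emod_nonneg (((ξ j : ℕ) : ℤ) - (Zᵀ *ᵥ l) j) h0.ne'
    have := Int.emod_lt_of_pos (((ξ j : ℕ) : ℤ) - (Zᵀ *ᵥ l) j) h0
    omega⟩

lemma indexShift_coe (Z : Matrix (Fin d) (Fin r) ℤ) (hn : ∀ j, 0 < n j) (l : Fin d → ℤ)
    (ξ : MultiIndex n) (j : Fin r) :
    ((indexShift Z hn l ξ j : ℕ) : ℤ) = (((ξ j : ℕ) : ℤ) - (Zᵀ *ᵥ l) j) % (n j : ℤ) := by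
  have h0 : (0 : ℤ) < n j := by exact_mod_cast hn j
  exact Int.toNat_of_nonneg (Int.emod_nonneg _ h0.ne')

lemma indexShift_bijective (Z : Matrix (Fin d) (Fin r) ℤ) (hn : ∀ j, 0 < n j)
    (l : Fin d → ℤ) : Function.Bijective (indexShift Z hn l) := by
  refine (Finite.injective_iff_bijective).1 fun ξ η h => funext fun j => ?_
  have h1 : (((ξ j : ℕ) : ℤ) - (Zᵀ *ᵥ l) j) ≡ (((η j : ℕ) : ℤ) - (Zᵀ *ᵥ l) j) [ZMOD n j] := by
    rw [Int.ModEq, ← indexShift_coe Z hn, ← indexShift_coe Z hn, h]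
  have h2 : ((ξ j : ℕ) : ℤ) ≡ ((η j : ℕ) : ℤ) [ZMOD n j] := by
    simpa using h1.add_right ((Zᵀ *ᵥ l) j)
  exact Fin.ext ((Int.natCast_modEq_iff.1 h2).eq_of_lt_of_lt (ξ j).2 (η j).2)

/-- Modulation by the character of frequency `l` is, on the Fourier side, an index shift. -/
lemma dftMatrix_mul_mFourier (Z : Matrix (Fin d) (Fin r) ℤ) (hn : ∀ j, 0 < n j) (l : Fin d → ℤ)
    (ξ k : MultiIndex n) :
    dftMatrix n ξ k * UnitAddTorus.mFourier l (latticePoint Z n k) =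
      dftMatrix n (indexShift Z hn l ξ) k := by
  rw [mFourier_latticePoint]
  simp only [dftMatrix, Matrix.of_apply]
  rw [← Finset.prod_mul_distrib]
  refine Finset.prod_congr rfl fun j _ => ?_
  rw [mul_assoc, ← Complex.exp_add]
  congr 1
  have hnj : (n j : ℂ) ≠ 0 := by exact_mod_cast (hn j).ne'
  set a : ℤ := (Zᵀ *ᵥ l) j
  set q : ℤ := (((ξ j : ℕ) : ℤ) - a) / (n j : ℤ)
  have hq : ((indexShift Z hn l ξ j : ℕ) : ℤ) = ((ξ j : ℕ) : ℤ) - a - n j * q := by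
    rw [indexShift_coe, Int.emod_def]
  have hq' : ((indexShift Z hn l ξ j : ℕ) : ℂ) = ((ξ j : ℕ) : ℂ) - a - n j * q := by
    exact_mod_cast congrArg (Int.cast : ℤ → ℂ) hq
  rw [Complex.exp_eq_exp_iff_exists_int]
  refine ⟨-((k j : ℕ) : ℤ) * q, ?_⟩
  rw [hq']
  push_cast
  field_simp
  ring

/-- `W` is the superposition of the index shifts, weighted by the Fourier coefficients of `v`. -/
lemma hasSum_Wmat_mulVec (Z : Matrix (Fin d) (Fin r) ℤ) (hn : ∀ j, 0 < n j)
    (v : C(UnitAddTorus (Fin d), ℝ))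
    (hv : Summable (UnitAddTorus.mFourierCoeff fun x => ((v x : ℝ) : ℂ)))
    (y : MultiIndex n → ℂ) (ξ : MultiIndex n) :
    HasSum (fun l : Fin d → ℤ => UnitAddTorus.mFourierCoeff (fun x => ((v x : ℝ) : ℂ)) l *
      y (indexShift Z hn l ξ)) ((Wmat Z n v *ᵥ y) ξ) := by
  set z := (dftMatrix n)⁻¹ *ᵥ y with hz
  have hy : y = dftMatrix n *ᵥ z := by
    rw [hz, Matrix.mulVec_mulVec, dftMatrix_mul_inv hn, Matrix.one_mulVec]
  have hW : (Wmat Z n v *ᵥ y) ξ = ∑ k, dftMatrix n ξ k * v (latticePoint Z n k) * z k := by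
    rw [Wmat, ← Matrix.mulVec_mulVec, ← hz, potentialMatrix]
    simp only [Matrix.mulVec, dotProduct, Matrix.mul_diagonal]
  let vC : C(UnitAddTorus (Fin d), ℂ) := ⟨fun x => ((v x : ℝ) : ℂ), by fun_prop⟩
  have hs : ∀ k, HasSum (fun l => dftMatrix n ξ k * (UnitAddTorus.mFourierCoeff vC l •
      UnitAddTorus.mFourier l (latticePoint Z n k)) * z k)
      (dftMatrix n ξ k * v (latticePoint Z n k) * z k) := fun k =>
    ((UnitAddTorus.hasSum_mFourier_series_apply_of_summable (f := vC) hv _).mul_left _).mul_right _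
  have hsum := hasSum_sum fun k (_ : k ∈ (Finset.univ : Finset (MultiIndex n))) => hs k
  rw [hW]
  refine hsum.congr_fun fun l => ?_
  rw [hy, Matrix.mulVec, dotProduct, Finset.mul_sum]
  refine Finset.sum_congr rfl fun k _ => ?_
  rw [← dftMatrix_mul_mFourier]
  simp only [vC, ContinuousMap.coe_mk, smul_eq_mul]
  ring

/-- A weight that grows by at most a factor `K l` under the index shift by `l` defines a norm in
which `W` is bounded by `∑ |v̂(l)| K l`. -/
lemma l2norm_mul_Wmat_le (Z : Matrix (Fin d) (Fin r) ℤ) (hn : ∀ j, 0 < n j)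
    (v : C(UnitAddTorus (Fin d), ℝ))
    (hv : Summable (UnitAddTorus.mFourierCoeff fun x => ((v x : ℝ) : ℂ)))
    {w : MultiIndex n → ℝ} (hw : ∀ ξ, 0 ≤ w ξ) {K : (Fin d → ℤ) → ℝ} (hK : ∀ l, 0 ≤ K l)
    (hwK : ∀ l ξ, w ξ ≤ K l * w (indexShift Z hn l ξ)) {S : ℝ}
    (hS : HasSum (fun l => ‖UnitAddTorus.mFourierCoeff (fun x => ((v x : ℝ) : ℂ)) l‖ * K l) S)
    (y : MultiIndex n → ℂ) :
    l2norm (fun ξ => (w ξ : ℂ) * (Wmat Z n v *ᵥ y) ξ) ≤ S * l2norm (fun ξ => (w ξ : ℂ) * y ξ) := by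
  set c := UnitAddTorus.mFourierCoeff fun x => ((v x : ℝ) : ℂ)
  have h1 : HasSum (fun l : Fin d → ℤ => fun ξ => (w ξ : ℂ) * (c l * y (indexShift Z hn l ξ)))
      (fun ξ => (w ξ : ℂ) * (Wmat Z n v *ᵥ y) ξ) :=
    Pi.hasSum.2 fun ξ => (hasSum_Wmat_mulVec Z hn v hv y ξ).mul_left _
  have h2 := (PiLp.continuousLinearEquiv 2 ℂ (fun _ : MultiIndex n => ℂ)).symm.hasSum'.2 h1
  have h3 := hS.mul_right (l2norm fun ξ => (w ξ : ℂ) * y ξ)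
  have h4 := tsum_of_norm_bounded (f := fun l => (PiLp.continuousLinearEquiv 2 ℂ
    (fun _ : MultiIndex n => ℂ)).symm (fun ξ => (w ξ : ℂ) * (c l * y (indexShift Z hn l ξ))))
    h3 fun l => ?_
  · rw [h2.tsum_eq] at h4
    exact h4
  change l2norm (fun ξ => (w ξ : ℂ) * (c l * y (indexShift Z hn l ξ))) ≤ _
  have hnn : ∀ z : MultiIndex n → ℂ, 0 ≤ l2norm z := fun z => norm_nonneg _
  refine (sq_le_sq₀ (hnn _) (mul_nonneg (mul_nonneg (norm_nonneg _) (hK l)) (hnn _))).1 ?_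
  rw [mul_pow, l2norm_sq, l2norm_sq,
    ← (indexShift_bijective Z hn l).sum_comp fun ξ => ‖(w ξ : ℂ) * y ξ‖ ^ 2, Finset.mul_sum]
  refine Finset.sum_le_sum fun ξ _ => ?_
  rw [← mul_pow]
  gcongr
  rw [norm_mul, norm_mul, norm_mul, Complex.norm_real, Complex.norm_real,
    Real.norm_of_nonneg (hw _), Real.norm_of_nonneg (hw _)]
  calc _ ≤ (K l * w (indexShift Z hn l ξ)) * (‖c l‖ * ‖y (indexShift Z hn l ξ)‖) := by
        gcongr
        exact hwK l ξ
    _ = _ := by ring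

/-- Since `h_ξ` is a shortest vector of its class, it is at most as long as `h_{ξ - Zᵀ l} + l`. -/
lemma freqNorm_le_indexShift {Z : Matrix (Fin d) (Fin r) ℤ} (hn : ∀ j, 0 < n j)
    {A : Finset (Fin d → ℤ)} {h : MultiIndex n → Fin d → ℤ} (hA : IsMinimalAntiAliasing Z n A h)
    (l : Fin d → ℤ) (ξ : MultiIndex n) :
    freqNorm (h ξ) ≤ freqNorm (h (indexShift Z hn l ξ)) + freqNorm l := by
  refine (hA.minimal ξ (h (indexShift Z hn l ξ) + l) fun j => ?_).trans (freqNorm_add_le _ _)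
  rw [Matrix.mulVec_add, Pi.add_apply]
  have h1 := (hA.index (indexShift Z hn l ξ) j).trans
    ((indexShift_coe Z hn l ξ j).symm ▸ Int.mod_modEq _ _)
  simpa using h1.add_right ((Zᵀ *ᵥ l) j)

lemma weight_le_indexShift {Z : Matrix (Fin d) (Fin r) ℤ} (hn : ∀ j, 0 < n j)
    {A : Finset (Fin d → ℤ)} {h : MultiIndex n → Fin d → ℤ} (hA : IsMinimalAntiAliasing Z n A h)
    {κ : ℝ} (hκ : 0 ≤ κ) (l : Fin d → ℤ) (ξ : MultiIndex n) :
    κ * freqNorm (h ξ) ^ 2 + 1 ≤ ((2 + 2 * κ) * (1 + freqNorm l ^ 2)) *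
      (κ * freqNorm (h (indexShift Z hn l ξ)) ^ 2 + 1) := by
  have h1 := freqNorm_le_indexShift hn hA l ξ
  have ha := freqNorm_nonneg (h ξ)
  set a := freqNorm (h ξ)
  set b := freqNorm (h (indexShift Z hn l ξ))
  set t := freqNorm l
  have h2 : a ^ 2 ≤ 2 * b ^ 2 + 2 * t ^ 2 := by nlinarith [sq_nonneg (b - t)]
  have h3 : κ * a ^ 2 ≤ κ * (2 * b ^ 2 + 2 * t ^ 2) := by gcongr
  have h4 : 0 ≤ κ * (κ * b ^ 2) := by positivity
  have h5 : 0 ≤ κ * (κ * b ^ 2) * t ^ 2 := by positivity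
  have h6 : 0 ≤ κ * b ^ 2 * t ^ 2 := by positivity
  nlinarith [sq_nonneg t]

end DFT

/-! ### Summability of weighted Fourier coefficients -/

section Summability

lemma summable_prod_comp {ι β : Type*} [Fintype ι] {f : β → ℝ} (hf0 : ∀ b, 0 ≤ f b)
    (hf : Summable f) : Summable fun l : ι → β => ∏ j, f (l j) := by
  classical
  refine summable_of_sum_le (c := ∏ _j : ι, ∑' b, f b)
    (fun l => Finset.prod_nonneg fun j _ => hf0 _) fun s => ?_
  calc ∑ l ∈ s, ∏ j, f (l j)
      ≤ ∑ l ∈ Fintype.piFinset fun j => s.image fun l => l j, ∏ j, f (l j) :=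
        Finset.sum_le_sum_of_subset_of_nonneg
          (fun l hl => Fintype.mem_piFinset.2 fun j => Finset.mem_image_of_mem (fun l => l j) hl)
          fun l _ _ => Finset.prod_nonneg fun j _ => hf0 _
    _ = ∏ j, ∑ b ∈ s.image fun l => l j, f b := (Finset.prod_univ_sum _ _).symm
    _ ≤ ∏ _j : ι, ∑' b, f b :=
        Finset.prod_le_prod (fun j _ => Finset.sum_nonneg fun b _ => hf0 b)
          fun j _ => hf.sum_le_tsum _ fun b _ => hf0 b

lemma summable_max_abs_rpow {b : ℝ} (hb : 1 < b) :
    Summable fun z : ℤ => max |(z : ℝ)| 1 ^ (-b) := by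
  refine (Real.summable_abs_int_rpow hb).congr_cofinite ?_
  filter_upwards [(Set.finite_singleton (0 : ℤ)).compl_mem_cofinite] with z hz
  have h1 : (1 : ℝ) ≤ |(z : ℝ)| := by exact_mod_cast Int.one_le_abs hz
  rw [max_eq_left h1]

variable {d : ℕ}

lemma korobovWeightSq_eq {α : ℝ} (hα : 0 ≤ α) (l : Fin d → ℤ) :
    korobovWeightSq α l = ∏ j, max |(l j : ℝ)| 1 ^ (2 * α) := by
  refine Finset.prod_congr rfl fun j _ => ?_
  rcases le_total |(l j : ℝ)| 1 with h | h
  · rw [max_eq_right h, Real.one_rpow,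
      max_eq_right (Real.rpow_le_one (abs_nonneg _) h (by positivity))]
  · rw [max_eq_left h, max_eq_left (Real.one_le_rpow h (by positivity))]

lemma one_add_freqNorm_sq_le (l : Fin d → ℤ) :
    1 + freqNorm l ^ 2 ≤ (d + 1) * ∏ j, max |(l j : ℝ)| 1 ^ 2 := by
  have hone : ∀ j, 1 ≤ max |(l j : ℝ)| 1 ^ 2 := fun j => one_le_pow₀ (le_max_right _ _)
  have h1 : 1 ≤ ∏ j, max |(l j : ℝ)| 1 ^ 2 := Finset.one_le_prod fun j _ => hone j
  have h2 : ∀ i, (l i : ℝ) ^ 2 ≤ ∏ j, max |(l j : ℝ)| 1 ^ 2 := fun i => by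
    have h3 : (l i : ℝ) ^ 2 ≤ max |(l i : ℝ)| 1 ^ 2 := by
      rw [← sq_abs]
      gcongr
      exact le_max_left _ _
    refine h3.trans ?_
    rw [← Finset.mul_prod_erase _ _ (Finset.mem_univ i)]
    exact le_mul_of_one_le_right (by positivity) (Finset.one_le_prod fun j _ => hone j)
  rw [freqNorm_sq]
  have h3 := Finset.sum_le_sum fun i (_ : i ∈ (Finset.univ : Finset (Fin d))) => h2 i
  simp only [Finset.sum_const, Finset.card_univ, Fintype.card_fin, nsmul_eq_mul] at h3
  linarith

/-- By Cauchy-Schwarz, `v ∈ E_α` has Fourier coefficients summable against `(1 + ‖l‖²)^m` as soon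
as `2α - 4m > 1`, in every dimension. -/
lemma summable_norm_mFourierCoeff_mul {α : ℝ} {m : ℕ} (hα : 4 * m + 1 < 2 * α)
    {f : UnitAddTorus (Fin d) → ℂ} (hf : MemKorobov α f) :
    Summable fun l : Fin d → ℤ => ‖UnitAddTorus.mFourierCoeff f l‖ * (1 + freqNorm l ^ 2) ^ m := by
  have hα0 : 0 ≤ α := by
    have : (0 : ℝ) ≤ m := Nat.cast_nonneg m
    linarith
  have hb : 1 < 2 * α - 4 * m := by linarith
  -- `(1 + ‖l‖²)^(2m)` is dominated by `∏ⱼ max(|lⱼ|, 1)^(4m)`, so that after division by the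
  -- Korobov weight a product of `d` copies of one convergent series over `ℤ` remains.
  have hs := summable_prod_comp (ι := Fin d) (fun z : ℤ => by positivity)
    (summable_max_abs_rpow hb)
  refine Summable.of_nonneg_of_le (fun l => by positivity) (fun l => ?_)
    (hf.2.add (hs.mul_left (((d : ℝ) + 1) ^ (2 * m))))
  set c := ‖UnitAddTorus.mFourierCoeff f l‖
  set P := ∏ j, max |(l j : ℝ)| 1 ^ 2 with hP
  set R := korobovWeightSq α l with hR
  set Q := ∏ j, max |(l j : ℝ)| 1 ^ (-(2 * α - 4 * m)) with hQ
  have hpos : ∀ j, 0 < max |(l j : ℝ)| 1 := fun j => lt_max_of_lt_right one_pos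
  have hRpos : 0 < R := by
    rw [hR, korobovWeightSq_eq hα0]
    exact Finset.prod_pos fun j _ => Real.rpow_pos_of_pos (hpos j) _
  have hPQ : (P ^ m) ^ 2 = R * Q := by
    rw [hP, hR, hQ, korobovWeightSq_eq hα0, ← Finset.prod_mul_distrib, ← pow_mul,
      ← Finset.prod_pow]
    refine Finset.prod_congr rfl fun j _ => ?_
    rw [← Real.rpow_add (hpos j), ← pow_mul, ← Real.rpow_natCast]
    congr 1
    push_cast
    ring
  have hle : (1 + freqNorm l ^ 2) ^ m ≤ ((d : ℝ) + 1) ^ m * P ^ m := by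
    rw [← mul_pow]
    gcongr
    exact one_add_freqNorm_sq_le l
  set B := ((d : ℝ) + 1) ^ m with hB
  have hBB : ((d : ℝ) + 1) ^ (2 * m) = B ^ 2 := by rw [hB, ← pow_mul, mul_comm]
  rw [hBB]
  have hc : 0 ≤ c := norm_nonneg _
  have h1 : c * (1 + freqNorm l ^ 2) ^ m ≤ c * (B * P ^ m) := by gcongr
  refine h1.trans ?_
  -- `2ab ≤ a² + b²` with `a = c √R` and `b = B √Q`
  have hQ0 : 0 ≤ Q := Finset.prod_nonneg fun j _ => by positivity
  have e : P ^ m = Real.sqrt R * Real.sqrt Q := by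
    rw [← Real.sqrt_mul hRpos.le, ← hPQ, Real.sqrt_sq]
    exact pow_nonneg (Finset.prod_nonneg fun j _ => by positivity) m
  have h2 := two_mul_le_add_sq (c * Real.sqrt R) (B * Real.sqrt Q)
  rw [mul_pow, mul_pow, Real.sq_sqrt hRpos.le, Real.sq_sqrt hQ0] at h2
  have h3 : 0 ≤ c * (B * P ^ m) := by
    rw [e]
    positivity
  rw [e] at h3 ⊢
  nlinarith

end Summability

/-! ### The `L₂` norm of trigonometric polynomials -/

section TrigPoly

variable {d : ℕ}

instance : IsProbabilityMeasure (torusMeasure d) := by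
  unfold torusMeasure
  infer_instance

lemma orthonormal_mFourier_torusMeasure : Orthonormal ℂ fun l : Fin d → ℤ =>
    ContinuousMap.toLp (E := ℂ) 2 (torusMeasure d) ℂ (UnitAddTorus.mFourier l) :=
  UnitAddTorus.orthonormal_mFourier

lemma L2dist_trigPoly {ι : Type*} [Fintype ι] {h : ι → Fin d → ℤ} (hh : Function.Injective h)
    (a b : ι → ℂ) :
    L2dist (trigPoly h a) (trigPoly h b) = ENNReal.ofReal (l2norm fun ξ => a ξ - b ξ) := by
  let f : C(UnitAddTorus (Fin d), ℂ) := ∑ ξ, (a ξ - b ξ) • UnitAddTorus.mFourier (h ξ)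
  have hf : (fun x => trigPoly h a x - trigPoly h b x) = f := by
    ext x
    simp [f, trigPoly, ContinuousMap.sum_apply, sub_mul]
  set F := ContinuousMap.toLp (E := ℂ) 2 (torusMeasure d) ℂ f with hF
  have hFsum : F = ∑ ξ, (a ξ - b ξ) •
      ContinuousMap.toLp (E := ℂ) 2 (torusMeasure d) ℂ (UnitAddTorus.mFourier (h ξ)) := by
    rw [hF, map_sum]
    simp only [map_smul]
  have hnorm : ‖F‖ ^ 2 = (l2norm fun ξ => a ξ - b ξ) ^ 2 := by
    have h1 := (orthonormal_mFourier_torusMeasure (d := d)).comp h hh |>.inner_sum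
      (fun ξ => a ξ - b ξ) (fun ξ => a ξ - b ξ) Finset.univ
    have h2 := inner_self_eq_norm_sq_to_K (𝕜 := ℂ) F
    simp only [Function.comp_def] at h1
    rw [hFsum, h1, ← hFsum] at h2
    rw [l2norm_sq]
    have h3 : ((∑ ξ, ‖a ξ - b ξ‖ ^ 2 : ℝ) : ℂ) = ((‖F‖ ^ 2 : ℝ) : ℂ) := by
      push_cast
      rw [← Complex.coe_algebraMap, ← h2]
      exact Finset.sum_congr rfl fun ξ _ => (Complex.conj_mul' _).symm
    exact_mod_cast h3.symm
  have hnorm' : ‖F‖ = l2norm fun ξ => a ξ - b ξ :=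
    (sq_eq_sq₀ (norm_nonneg _) (norm_nonneg _)).1 hnorm
  rw [L2dist, hf, ← hnorm', ofReal_norm, Lp.enorm_def]
  exact eLpNorm_congr_ae (ContinuousMap.coeFn_toLp (torusMeasure d) f).symm

end TrigPoly

/-! ### The collocated equation in Euclidean space -/

section Transfer

variable {ι : Type*} [Fintype ι] [DecidableEq ι]

open scoped Matrix.Norms.L2Operator in
lemma toEuclideanCLM_exp (A : Matrix ι ι ℂ) :
    Matrix.toEuclideanCLM (𝕜 := ℂ) (n := ι) (NormedSpace.exp A) =
      NormedSpace.exp (Matrix.toEuclideanCLM (𝕜 := ℂ) (n := ι) A) := by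
  let _ : NormedAlgebra ℚ (Matrix ι ι ℂ) := NormedAlgebra.restrictScalars ℚ ℂ _
  let _ : NormedAlgebra ℚ (EuclideanSpace ℂ ι →L[ℂ] EuclideanSpace ℂ ι) :=
    NormedAlgebra.restrictScalars ℚ ℂ _
  refine NormedSpace.map_exp (Matrix.toEuclideanCLM (𝕜 := ℂ) (n := ι)) ?_ A
  exact (Matrix.toEuclideanCLM (𝕜 := ℂ) (n := ι)).toAlgEquiv.toLinearEquiv.toLinearMap
    |>.continuous_of_finiteDimensional

/-- The kinetic generator `-i(γ/2) D` as an operator. -/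
def kineticOp (γ : ℝ) (D : Matrix ι ι ℂ) : EuclideanSpace ℂ ι →L[ℂ] EuclideanSpace ℂ ι :=
  Matrix.toEuclideanCLM (𝕜 := ℂ) (n := ι) (-(Complex.I * (γ : ℂ) / 2) • D)

/-- Half the potential generator, `-(i/(2γ)) W`, as an operator. -/
def halfPotentialOp (γ : ℝ) (W : Matrix ι ι ℂ) : EuclideanSpace ℂ ι →L[ℂ] EuclideanSpace ℂ ι :=
  Matrix.toEuclideanCLM (𝕜 := ℂ) (n := ι) (-(Complex.I / (2 * (γ : ℂ))) • W)

lemma toEuclideanCLM_strangStep (γ τ : ℝ) (D W : Matrix ι ι ℂ) :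
    Matrix.toEuclideanCLM (𝕜 := ℂ) (n := ι) (strangStep γ τ D W) =
      strangProp (kineticOp γ D) (halfPotentialOp γ W) τ := by
  simp only [strangStep, strangProp, kineticOp, halfPotentialOp, map_mul, toEuclideanCLM_exp,
    ← map_smul, smul_smul, mul_comm (τ : ℂ)]

lemma toLp_strangIterate (γ τ : ℝ) (D W : Matrix ι ι ℂ) (y : ι → ℂ) (k : ℕ) :
    (WithLp.toLp 2 (strangIterate γ τ D W y k) : EuclideanSpace ℂ ι) =
      (strangProp (kineticOp γ D) (halfPotentialOp γ W) τ ^ k) (WithLp.toLp 2 y) := by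
  induction k with
  | zero => rfl
  | succ k ih =>
    rw [pow_succ', mul_apply_eq_comp, ← ih, strangIterate, ← toEuclideanCLM_strangStep,
      Matrix.toEuclideanCLM_toLp]

lemma star_kineticOp (γ : ℝ) {D : Matrix ι ι ℂ} (hD : D.IsHermitian) :
    star (kineticOp γ D) = -kineticOp γ D := by
  rw [kineticOp, ← map_star, star_smul, Matrix.star_eq_conjTranspose, hD.eq, ← map_neg, ← neg_smul]
  congr 2
  simp [neg_div]

lemma star_halfPotentialOp (γ : ℝ) {W : Matrix ι ι ℂ} (hW : W.IsHermitian) :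
    star (halfPotentialOp γ W) = -halfPotentialOp γ W := by
  rw [halfPotentialOp, ← map_star, star_smul, Matrix.star_eq_conjTranspose, hW.eq, ← map_neg,
    ← neg_smul]
  congr 2
  simp [neg_div]

lemma SolvesCollocationODE.hasDerivWithinAt {γ : ℝ} (hγ : 0 < γ) {D W : Matrix ι ι ℂ}
    {u₀ : ι → ℂ} {T : ℝ} {u : ℝ → ι → ℂ} (hu : SolvesCollocationODE γ D W u₀ T u) {s : ℝ}
    (hs : s ∈ Set.Icc 0 T) :
    HasDerivWithinAt (fun t => (WithLp.toLp 2 (u t) : EuclideanSpace ℂ ι))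
      ((kineticOp γ D + halfPotentialOp γ W + halfPotentialOp γ W) (WithLp.toLp 2 (u s)))
      (Set.Icc 0 T) s := by
  obtain ⟨u', hu', he⟩ := hu.2 s hs
  have h1 : HasDerivWithinAt (fun t => (WithLp.toLp 2 (u t) : EuclideanSpace ℂ ι))
      (WithLp.toLp 2 u') (Set.Icc 0 T) s :=
    ((PiLp.continuousLinearEquiv 2 ℂ (fun _ : ι => ℂ)).symm.toContinuousLinearMap.restrictScalars
      ℝ).hasFDerivAt.comp_hasDerivWithinAt s hu'
  refine h1.congr_deriv ?_
  simp only [kineticOp, halfPotentialOp, _root_.add_apply, Matrix.toEuclideanCLM_toLp,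
    ← WithLp.toLp_add]
  congr 1
  have hγ' : (γ : ℂ) ≠ 0 := by exact_mod_cast hγ.ne'
  ext ξ
  have := congrFun he ξ
  simp only [Pi.smul_apply, Pi.add_apply, smul_eq_mul, Matrix.smul_mulVec] at this ⊢
  field_simp
  linear_combination (-2 * Complex.I) * this + 2 * u' ξ * γ * Complex.I_sq

end Transfer

/-! ### Bounds uniform in the lattice -/

section Collocation

variable {d r : ℕ} {n : Fin r → ℕ}

/-- The factor by which the weight `(γ/2) D + 1` can grow under the index shift by `l`. -/
def shiftGrowth (γ : ℝ) (l : Fin d → ℤ) : ℝ :=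
  (2 + 2 * (γ / 2 * (4 * Real.pi ^ 2))) * (1 + freqNorm l ^ 2)

lemma one_le_shiftGrowth {γ : ℝ} (hγ : 0 < γ) (l : Fin d → ℤ) : 1 ≤ shiftGrowth γ l := by
  have h1 : 0 ≤ γ / 2 * (4 * Real.pi ^ 2) := by positivity
  have h2 : 0 ≤ freqNorm l ^ 2 := sq_nonneg _
  rw [shiftGrowth]
  nlinarith [mul_nonneg h1 h2]

/-- A bound, independent of the lattice, for half the potential in the norms `‖((γ/2) D + 1)^m ·‖`,
`m ≤ p`. If the series diverges, the value is `0` and bounds nothing, so its summability is a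
hypothesis wherever the bound is claimed. -/
def potentialBound (γ : ℝ) (v : UnitAddTorus (Fin d) → ℝ) (p : ℕ) : ℝ :=
  (2 * γ)⁻¹ * ∑' l : Fin d → ℤ,
    ‖UnitAddTorus.mFourierCoeff (fun x => ((v x : ℝ) : ℂ)) l‖ * shiftGrowth γ l ^ p

lemma potentialBound_nonneg {γ : ℝ} (hγ : 0 < γ) (v : UnitAddTorus (Fin d) → ℝ) (p : ℕ) :
    0 ≤ potentialBound γ v p :=
  mul_nonneg (by positivity) (tsum_nonneg fun l => mul_nonneg (norm_nonneg _)
    (pow_nonneg (zero_le_one.trans (one_le_shiftGrowth hγ l)) p))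

/-- The operator `(γ/2) D + 1` with `D = Dmat h`. -/
def weightOp (γ : ℝ) (h : MultiIndex n → Fin d → ℤ) :
    EuclideanSpace ℂ (MultiIndex n) →L[ℂ] EuclideanSpace ℂ (MultiIndex n) :=
  Matrix.toEuclideanCLM (𝕜 := ℂ) (n := MultiIndex n) (((γ : ℂ) / 2) • Dmat h + 1)

lemma weightMatrix_eq (γ : ℝ) (h : MultiIndex n → Fin d → ℤ) :
    ((γ : ℂ) / 2) • Dmat h + 1 = Matrix.diagonal fun ξ =>
      ((γ / 2 * (4 * Real.pi ^ 2) * freqNorm (h ξ) ^ 2 + 1 : ℝ) : ℂ) := by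
  rw [Dmat, ← Matrix.diagonal_smul, ← Matrix.diagonal_one, Matrix.diagonal_add]
  congr 1
  ext ξ
  simp
  ring

lemma norm_weightOp_pow_apply (γ : ℝ) (h : MultiIndex n → Fin d → ℤ) (p : ℕ)
    (y : EuclideanSpace ℂ (MultiIndex n)) :
    ‖(weightOp γ h ^ p) y‖ = l2norm fun ξ =>
      (((γ / 2 * (4 * Real.pi ^ 2) * freqNorm (h ξ) ^ 2 + 1) ^ p : ℝ) : ℂ) * y ξ := by
  rw [weightOp, ← map_pow, weightMatrix_eq, Matrix.diagonal_pow, l2norm]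
  congr 1
  ext ξ
  rw [Matrix.ofLp_toEuclideanCLM, Matrix.mulVec_diagonal]
  simp

lemma norm_weightOp_pow_toLp (γ : ℝ) (h : MultiIndex n → Fin d → ℤ) (p : ℕ)
    (y : MultiIndex n → ℂ) : ‖(weightOp γ h ^ p) (WithLp.toLp 2 y)‖ =
      l2norm ((((γ : ℂ) / 2) • Dmat h + 1) ^ p *ᵥ y) := by
  rw [weightOp, ← map_pow, Matrix.toEuclideanCLM_toLp, l2norm]

lemma norm_le_norm_weightOp {γ : ℝ} (hγ : 0 < γ) (h : MultiIndex n → Fin d → ℤ)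
    (y : EuclideanSpace ℂ (MultiIndex n)) : ‖y‖ ≤ ‖weightOp γ h y‖ := by
  have e := norm_weightOp_pow_apply γ h 1 y
  rw [pow_one] at e
  rw [e]
  refine l2norm_le_l2norm (a := fun ξ => y ξ) fun ξ => ?_
  have h1 : 0 ≤ γ / 2 * (4 * Real.pi ^ 2) * freqNorm (h ξ) ^ 2 := by positivity
  rw [norm_mul, Complex.norm_real, Real.norm_of_nonneg (by positivity), pow_one]
  exact le_mul_of_one_le_left (norm_nonneg _) (by linarith)

lemma norm_kineticOp_le_norm_weightOp {γ : ℝ} (hγ : 0 < γ) (h : MultiIndex n → Fin d → ℤ)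
    (y : EuclideanSpace ℂ (MultiIndex n)) :
    ‖kineticOp γ (Dmat h) y‖ ≤ ‖weightOp γ h y‖ := by
  have e := norm_weightOp_pow_apply γ h 1 y
  rw [pow_one] at e
  rw [e]
  refine l2norm_le_l2norm (a := fun ξ => kineticOp γ (Dmat h) y ξ) fun ξ => ?_
  have h1 : 0 ≤ γ / 2 * (4 * Real.pi ^ 2) * freqNorm (h ξ) ^ 2 := by positivity
  have e2 : kineticOp γ (Dmat h) y ξ = (-Complex.I) *
      (((γ / 2 * (4 * Real.pi ^ 2) * freqNorm (h ξ) ^ 2 : ℝ) : ℂ) * y ξ) := by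
    rw [kineticOp, Matrix.ofLp_toEuclideanCLM, Matrix.smul_mulVec, Dmat, Pi.smul_apply,
      Matrix.mulVec_diagonal, smul_eq_mul]
    push_cast
    ring
  rw [e2, norm_mul, norm_neg, Complex.norm_I, one_mul, norm_mul, norm_mul, Complex.norm_real,
    Complex.norm_real, Real.norm_of_nonneg h1, Real.norm_of_nonneg (by positivity), pow_one]
  gcongr
  linarith

lemma commute_weightOp_kineticOp (γ : ℝ) (h : MultiIndex n → Fin d → ℤ) :
    Commute (weightOp γ h) (kineticOp γ (Dmat h)) := by
  refine Commute.map (f := Matrix.toEuclideanCLM (𝕜 := ℂ) (n := MultiIndex n)) ?_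
  exact (((Commute.refl _).smul_left _).add_left (Commute.one_left _)).smul_right _

lemma Dmat_isHermitian (h : MultiIndex n → Fin d → ℤ) : (Dmat h).IsHermitian := by
  rw [Dmat, Matrix.isHermitian_diagonal_iff]
  intro ξ
  exact Complex.conj_ofReal _

/-- The potential is bounded in the norms `‖((γ/2) D + 1)^m ·‖`, uniformly in the lattice. -/
lemma norm_weightOp_pow_halfPotentialOp_le {γ : ℝ} (hγ : 0 < γ) {Z : Matrix (Fin d) (Fin r) ℤ}
    (hn : ∀ j, 0 < n j) {A : Finset (Fin d → ℤ)} {h : MultiIndex n → Fin d → ℤ}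
    (hA : IsMinimalAntiAliasing Z n A h) {v : C(UnitAddTorus (Fin d), ℝ)} {p m : ℕ} (hm : m ≤ p)
    (hv : Summable fun l : Fin d → ℤ =>
      ‖UnitAddTorus.mFourierCoeff (fun x => ((v x : ℝ) : ℂ)) l‖ * (1 + freqNorm l ^ 2) ^ p)
    (y : EuclideanSpace ℂ (MultiIndex n)) :
    ‖(weightOp γ h ^ m) (halfPotentialOp γ (Wmat Z n v) y)‖ ≤
      potentialBound γ v p * ‖(weightOp γ h ^ m) y‖ := by
  have hκ : 0 ≤ γ / 2 * (4 * Real.pi ^ 2) := by positivity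
  have hv' : Summable fun l : Fin d → ℤ =>
      ‖UnitAddTorus.mFourierCoeff (fun x => ((v x : ℝ) : ℂ)) l‖ * shiftGrowth γ l ^ p := by
    refine (hv.mul_right ((2 + 2 * (γ / 2 * (4 * Real.pi ^ 2))) ^ p)).congr fun l => ?_
    rw [shiftGrowth, mul_pow]
    ring
  have hv0 : Summable (UnitAddTorus.mFourierCoeff fun x => ((v x : ℝ) : ℂ)) :=
    .of_norm_bounded hv' fun l =>
      le_mul_of_one_le_right (norm_nonneg _) (one_le_pow₀ (one_le_shiftGrowth hγ l))
  have hw0 : ∀ ξ, 0 ≤ γ / 2 * (4 * Real.pi ^ 2) * freqNorm (h ξ) ^ 2 + 1 :=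
    fun ξ => by positivity
  have key := l2norm_mul_Wmat_le Z hn v hv0
    (w := fun ξ => (γ / 2 * (4 * Real.pi ^ 2) * freqNorm (h ξ) ^ 2 + 1) ^ m)
    (fun ξ => pow_nonneg (hw0 ξ) m) (K := fun l => shiftGrowth γ l ^ p)
    (fun l => pow_nonneg (zero_le_one.trans (one_le_shiftGrowth hγ l)) p)
    (fun l ξ => by
      refine (pow_le_pow_left₀ (hw0 ξ) (weight_le_indexShift hn hA hκ l ξ) m).trans ?_
      rw [mul_pow]
      exact mul_le_mul_of_nonneg_right (pow_le_pow_right₀ (one_le_shiftGrowth hγ l) hm)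
        (pow_nonneg (hw0 _) m)) hv'.hasSum y
  rw [norm_weightOp_pow_apply, norm_weightOp_pow_apply]
  have e : (fun ξ => (((γ / 2 * (4 * Real.pi ^ 2) * freqNorm (h ξ) ^ 2 + 1) ^ m : ℝ) : ℂ) *
      halfPotentialOp γ (Wmat Z n v) y ξ) = (-(Complex.I / (2 * (γ : ℂ)))) •
      fun ξ => (((γ / 2 * (4 * Real.pi ^ 2) * freqNorm (h ξ) ^ 2 + 1) ^ m : ℝ) : ℂ) *
        (Wmat Z n v *ᵥ y) ξ := by
    ext ξ
    rw [halfPotentialOp, Matrix.ofLp_toEuclideanCLM, Matrix.smul_mulVec, Pi.smul_apply,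
      Pi.smul_apply, smul_eq_mul, smul_eq_mul]
    ring
  have e2 : ‖-(Complex.I / (2 * (γ : ℂ)))‖ = (2 * γ)⁻¹ := by
    simp [abs_of_pos hγ]
  rw [e, l2norm_smul, e2, potentialBound, mul_assoc]
  exact mul_le_mul_of_nonneg_left key (by positivity)

lemma IsMinimalAntiAliasing.injective {Z : Matrix (Fin d) (Fin r) ℤ} {A : Finset (Fin d → ℤ)}
    {h : MultiIndex n → Fin d → ℤ} (hA : IsMinimalAntiAliasing Z n A h) :
    Function.Injective h := by
  intro ξ η e
  funext j
  have h1 := (hA.index ξ j).symm.trans (e ▸ hA.index η j)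
  exact Fin.ext ((Int.natCast_modEq_iff.1 h1).eq_of_lt_of_lt (ξ j).2 (η j).2)

/-- Reduction of the error estimate on the torus to one in Euclidean space. -/
lemma exists_isGreatest_and_L2dist_le {γ : ℝ} (hγ : 0 < γ) {Z : Matrix (Fin d) (Fin r) ℤ}
    {A : Finset (Fin d → ℤ)} {h : MultiIndex n → Fin d → ℤ}
    (hA : IsMinimalAntiAliasing Z n A h) {W : Matrix (MultiIndex n) (MultiIndex n) ℂ}
    {u₀ : MultiIndex n → ℂ} {T : ℝ} {u : ℝ → MultiIndex n → ℂ}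
    (hu : SolvesCollocationODE γ (Dmat h) W u₀ T u) {τ : ℝ} (hτ : 0 < τ) {k : ℕ}
    (hk : k * τ ≤ T) (p : ℕ) {C : ℝ}
    (hC : ∀ M, (∀ s ∈ Set.Icc 0 (k * τ), ‖(weightOp γ h ^ p) (WithLp.toLp 2 (u s))‖ ≤ M) →
      ‖(strangProp (kineticOp γ (Dmat h)) (halfPotentialOp γ W) τ ^ k) (WithLp.toLp 2 (u 0)) -
        WithLp.toLp 2 (u (k * τ))‖ ≤ τ ^ p * C * (k * τ) * M) :
    ∃ M : ℝ, IsGreatest ((fun s => l2norm ((((γ : ℂ) / 2) • Dmat h + 1) ^ p *ᵥ u s)) ''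
        Set.Icc 0 (k * τ)) M ∧
      L2dist (trigPoly h (strangIterate γ τ (Dmat h) W u₀ k)) (trigPoly h (u (k * τ)))
        ≤ ENNReal.ofReal (τ ^ p * C * (k * τ) * M) := by
  have hk0 : 0 ≤ k * τ := by positivity
  have hcont : ContinuousOn (fun s => l2norm ((((γ : ℂ) / 2) • Dmat h + 1) ^ p *ᵥ u s))
      (Set.Icc 0 (k * τ)) := by
    simp only [← norm_weightOp_pow_toLp]
    refine ((weightOp γ h ^ p).continuous.comp_continuousOn fun s hs => ?_).norm
    exact (hu.hasDerivWithinAt hγ ⟨hs.1, hs.2.trans hk⟩).continuousWithinAt.mono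
      (Set.Icc_subset_Icc_right hk)
  obtain ⟨M, hM⟩ := (isCompact_Icc.image_of_continuousOn hcont).exists_isGreatest
    ((Set.nonempty_Icc.2 hk0).image _)
  refine ⟨M, hM, ?_⟩
  rw [L2dist_trigPoly hA.injective]
  refine ENNReal.ofReal_le_ofReal ?_
  have h1 := hC M fun s hs => by
    rw [norm_weightOp_pow_toLp]
    exact hM.2 ⟨s, hs, rfl⟩
  rw [hu.1, ← toLp_strangIterate, ← WithLp.toLp_sub] at h1
  exact h1

end Collocation

end LatticeTDSE

end

theorem theorem2p5 (d : ℕ) (γ : ℝ) (hγ : 0 < γ) (α : ℝ) (hα : 2 ≤ α)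
    (v : C(UnitAddTorus (Fin d), ℝ)) (hv : MemKorobov α fun x => ((v x : ℝ) : ℂ)) :
    ∃ C₁ > (0 : ℝ), ∃ C₂ > (0 : ℝ),
      ∀ (r : ℕ) (Z : Matrix (Fin d) (Fin r) ℤ) (n : Fin r → ℕ), IsCanonical Z n →
      ∀ (A : Finset (Fin d → ℤ)) (h : MultiIndex n → (Fin d → ℤ)), IsMinimalAntiAliasing Z n A h →
      ∀ (β : ℝ), 2 ≤ β → ∀ g : C(UnitAddTorus (Fin d), ℂ), MemKorobov β g →
      ∀ (T : ℝ) (u : ℝ → MultiIndex n → ℂ),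
        SolvesCollocationODE γ (Dmat h) (Wmat Z n v) (fun ξ => latticeCoeff Z n g (h ξ)) T u →
      ∀ (Δt : ℝ), 0 < Δt → ∀ (k : ℕ), k * Δt ≤ T →
        (5 / 2 < α → ∃ M : ℝ,
          IsGreatest ((fun s => l2norm ((((γ : ℂ) / 2) • Dmat h + 1) *ᵥ u s)) ''
            Set.Icc 0 (k * Δt)) M ∧
          L2dist
            (trigPoly h (strangIterate γ Δt (Dmat h) (Wmat Z n v)
              (fun ξ => latticeCoeff Z n g (h ξ)) k))
            (trigPoly h (u (k * Δt)))
            ≤ ENNReal.ofReal (Δt * C₁ * (k * Δt) * M)) ∧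
        (9 / 2 < α → ∃ M : ℝ,
          IsGreatest ((fun s => l2norm ((((γ : ℂ) / 2) • Dmat h + 1) ^ 2 *ᵥ u s)) ''
            Set.Icc 0 (k * Δt)) M ∧
          L2dist
            (trigPoly h (strangIterate γ Δt (Dmat h) (Wmat Z n v)
              (fun ξ => latticeCoeff Z n g (h ξ)) k))
            (trigPoly h (u (k * Δt)))
            ≤ ENNReal.ofReal (Δt ^ 2 * C₂ * (k * Δt) * M)) := by
  have hc₁ := potentialBound_nonneg hγ v 1
  have hc₂ := potentialBound_nonneg hγ v 2
  set c₁ := potentialBound γ v 1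
  set c₂ := potentialBound γ v 2
  refine ⟨(2 * c₁ * Real.exp c₁ + 2 * c₁) * Real.exp c₁ + 2, by positivity,
    (4 * c₂ ^ 2 * Real.exp c₂ + 4 * c₂) * Real.exp c₂ + 2, by positivity, ?_⟩
  intro r Z n hZ A h hA β _ g _ T u hu τ hτ k hk
  have hX := star_kineticOp γ (Dmat_isHermitian h)
  have hY := star_halfPotentialOp γ (Wmat_isHermitian Z hZ.modulus_pos v)
  refine ⟨fun hα1 => ?_, fun hα2 => ?_⟩
  · have hs := summable_norm_mFourierCoeff_mul (m := 1) (by push_cast; linarith) hv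
    have hB := fun m (hm : m ≤ 1) =>
      norm_weightOp_pow_halfPotentialOp_le hγ hZ.modulus_pos hA hm hs
    have key := exists_isGreatest_and_L2dist_le hγ hA hu hτ hk 1
      (C := (2 * c₁ * Real.exp c₁ + 2 * c₁) * Real.exp c₁ + 2) fun M hM => by
        rw [pow_one]
        exact norm_strangProp_pow_sub_le_first hc₁ hX hY (commute_weightOp_kineticOp γ h)
          (norm_le_norm_weightOp hγ h) (norm_kineticOp_le_norm_weightOp hγ h)
          (by simpa using hB 0 zero_le_one) (by simpa using hB 1 le_rfl) hτ hk
          (u := fun s => WithLp.toLp 2 (u s)) (fun s hs => hu.hasDerivWithinAt hγ hs)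
          (by simpa using hM)
    simpa using key
  · have hs := summable_norm_mFourierCoeff_mul (m := 2) (by push_cast; linarith) hv
    have hB := fun m (hm : m ≤ 2) =>
      norm_weightOp_pow_halfPotentialOp_le hγ hZ.modulus_pos hA hm hs
    exact exists_isGreatest_and_L2dist_le hγ hA hu hτ hk 2 fun M hM =>
      norm_strangProp_pow_sub_le_second hc₂ hX hY (commute_weightOp_kineticOp γ h)
        (norm_le_norm_weightOp hγ h) (norm_kineticOp_le_norm_weightOp hγ h)
        (by simpa using hB 0 zero_le_two) (by simpa using hB 1 one_le_two) (hB 2 le_rfl) hτ hk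
        (u := fun s => WithLp.toLp 2 (u s)) (fun s hs => hu.hasDerivWithinAt hγ hs) hM
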